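/- Let $a,b,E>0$ be real numbers. For each $\gamma>0$, consider the planar system $$\partial_x\psi=v,\qquad \partial_x v=2\bigl(\gamma+a\psi^2-b\psi^4\bigr)v-2E\psi .$$ A closed orbit is the image $\Gamma\subset\mathbb{R}^2$ of a nonconstant periodic solution, and a limit cycle is an isolated closed orbit, i.e. one with a neighbourhood that meets no other closed orbit. Then the system has exactly one closed orbit $\Gamma$. It is a limit cycle (so the system has exactly one limit cycle), and it is attracting, i.e. orbitally asymptotically stable: there is $\delta>0$ such that from every point at distance less than $\delta$ from $\Gamma$ a solution exists for all $x\ge 0$ and every such solution satisfies $\operatorname{dist}((\psi(x),v(x)),\Gamma)\to 0$ as $x\to+\infty$; and for every $\varepsilon>0$ there is $\delta>0$ such that every solution on $[0,\infty)$ starting at distance less than $\delta$ from $\Gamma$ stays at distance less than $\varepsilon$ from $\Gamma$ for all $x\ge0$. -/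

import Mathlib

open Set Filter Topology

namespace PlanarFlow

variable {V : Type*} [NormedAddCommGroup V] [NormedSpace ℝ V]

/-- `z` is a solution of the autonomous equation `z' = X z` on the half-line `[0, ∞)`
(with the one-sided derivative at `0`). -/
def IsForwardSolution (X : V → V) (z : ℝ → V) : Prop :=
  IsIntegralCurveOn z (fun _ => X) (Ici 0)

/-- `Γ` is a closed (periodic) orbit of `z' = X z`: the image of a nonconstant periodic solution
defined on all of `ℝ`. -/
def IsClosedOrbit (X : V → V) (Γ : Set V) : Prop :=
  ∃ z : ℝ → V, IsIntegralCurve z (fun _ => X) ∧ (∃ T : ℝ, 0 < T ∧ Function.Periodic z T) ∧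
    (∃ t : ℝ, z t ≠ z 0) ∧ Γ = range z

/-- A limit cycle of `z' = X z`: an isolated closed orbit, that is, a closed orbit with a
neighbourhood that meets no other closed orbit. -/
def IsLimitCycle (X : V → V) (Γ : Set V) : Prop :=
  IsClosedOrbit X Γ ∧
    ∃ U : Set V, IsOpen U ∧ Γ ⊆ U ∧ ∀ Γ' : Set V, IsClosedOrbit X Γ' → (Γ' ∩ U).Nonempty → Γ' = Γ

/-- `Γ` is attracting (orbitally asymptotically stable) for `z' = X z`.
First conjunct: from every point near `Γ` there is a solution for all forward time, and every such
solution converges to `Γ`. Second conjunct: forward solutions that start close enough to `Γ` stay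
as close to `Γ` as desired. -/
def IsAttracting (X : V → V) (Γ : Set V) : Prop :=
  (∃ δ : ℝ, 0 < δ ∧ ∀ p : V, Metric.infDist p Γ < δ →
    (∃ z : ℝ → V, IsForwardSolution X z ∧ z 0 = p) ∧
    ∀ z : ℝ → V, IsForwardSolution X z → z 0 = p →
      Tendsto (fun t => Metric.infDist (z t) Γ) atTop (𝓝 0)) ∧
  ∀ ε : ℝ, 0 < ε → ∃ δ : ℝ, 0 < δ ∧ ∀ z : ℝ → V, IsForwardSolution X z →
    Metric.infDist (z 0) Γ < δ → ∀ t : ℝ, 0 ≤ t → Metric.infDist (z t) Γ < ε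

/-- The vector field of the planar system
`ψ' = v`, `v' = 2 (γ + a ψ² - b ψ⁴) v - 2 E ψ` at the point `p = (ψ, v)`. -/
def planarField (γ a b E : ℝ) (p : ℝ × ℝ) : ℝ × ℝ :=
  (p.2, 2 * (γ + a * p.1 ^ 2 - b * p.1 ^ 4) * p.2 - 2 * E * p.1)

end PlanarFlow

open PlanarFlow

/-! The damping `f = -2 (γ + a ψ² - b ψ⁴)` is even, negative on an interval `(-β, β)` and positive
outside, and its odd primitive `F` becomes positive beyond `β`. Since the field is odd, a closed
orbit arises from a fixed point of the half return map `m ↦ m'`, which follows the orbit of `(-m,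
0)` through `v > 0` to `(m', 0)`.

The heart is a contraction. Put `W = v² + k (x² - β²)` and `u = √W`. Along an orbit written as a
graph `v = y(x)` one has `u' = -f y / u`. For two orbits over the same `x`, the product `(u₂ -
u₁)(y₂/u₂ - y₁/u₁)` is zero or has the sign of `x² - β²`, which is the sign of `f`; hence `|u₂ -
u₁|` never increases (`abs_root_sub_root_le`). The outer orbit also loses energy strictly before the
inner one starts, so the half return map strictly shrinks differences of the heights `√(k (m² -
β²))` (`abs_height_sub_height_lt`).

Existence: the contraction makes the map continuous, large amplitudes decrease because `F r > 0`
(`exists_forall_isArc_le`), and the intermediate value theorem gives a fixed point. Attraction: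
strict contraction and compactness drive the heights of successive half turns to that of the cycle
(`exists_height_decrease`), and Lipschitz dependence on initial values transfers this to solutions.
Uniqueness: a nonconstant periodic solution must enter `W > 0` and hence meets the `x`-axis outside
`[-β, β]`; it is then attracted to the cycle and, being periodic, lies on it. -/

/-- Data of a Liénard system `x' = v`, `v' = -f x * v - k * x`, with odd primitive `F` of the
damping `f`, whose damping is negative exactly on `(-β, β)` and has positive total mass on `[0, r]`. -/
structure LienardSystem where
  f : ℝ → ℝ
  F : ℝ → ℝ
  k : ℝ
  β : ℝ
  r : ℝ
  contDiff_f : ContDiff ℝ 1 f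
  hasDerivAt_F : ∀ x, HasDerivAt F (f x) x
  f_neg_arg : ∀ x, f (-x) = f x
  F_neg_arg : ∀ x, F (-x) = -F x
  k_pos : 0 < k
  β_pos : 0 < β
  f_neg : ∀ x, |x| < β → f x < 0
  f_pos : ∀ x, β < |x| → 0 < f x
  β_lt_r : β < r
  F_r_pos : 0 < F r

/-! ### Signs of the damping and of the level function. -/

namespace LienardSystem

variable (D : LienardSystem)

/-- The planar vector field of a Liénard system. -/
def field (p : ℝ × ℝ) : ℝ × ℝ := (p.2, -D.f p.1 * p.2 - D.k * p.1)

/-- The quantity `k * (x ^ 2 - β ^ 2)`, which has the sign of the damping at `x`. -/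
def level (x : ℝ) : ℝ := D.k * (x ^ 2 - D.β ^ 2)

/-- The shifted energy `v ^ 2 + k * (x ^ 2 - β ^ 2)`. -/
def shiftedEnergy (p : ℝ × ℝ) : ℝ := p.2 ^ 2 + D.level p.1

lemma continuous_f : Continuous D.f := D.contDiff_f.continuous

lemma level_neg_arg (x : ℝ) : D.level (-x) = D.level x := by simp [level]

lemma level_pos {x : ℝ} (h : D.β < |x|) : 0 < D.level x := by
  have := D.β_pos
  have : D.β ^ 2 < x ^ 2 := by rw [← sq_abs x]; gcongr
  exact mul_pos D.k_pos (by linarith)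

lemma level_nonpos {x : ℝ} (h : |x| ≤ D.β) : D.level x ≤ 0 := by
  have : x ^ 2 ≤ D.β ^ 2 := by rw [← sq_abs x]; gcongr
  exact mul_nonpos_of_nonneg_of_nonpos D.k_pos.le (by linarith)

lemma level_β : D.level D.β = 0 := by simp [level]

lemma level_mono {x y : ℝ} (hx : D.β ≤ x) (hxy : x ≤ y) : D.level x ≤ D.level y := by
  have h1 := D.β_pos
  have h2 := D.k_pos
  have h3 : 0 ≤ x := h1.le.trans hx
  unfold level; gcongr

lemma level_nonneg {x : ℝ} (h : D.β ≤ x) : 0 ≤ D.level x := by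
  rw [← D.level_β]; exact D.level_mono le_rfl h

lemma f_nonpos {x : ℝ} (h : |x| ≤ D.β) : D.f x ≤ 0 := by
  have hmem : x ∈ closure (Ioo (-D.β) D.β) := by
    rw [closure_Ioo (by linarith [D.β_pos])]; exact abs_le.mp h
  exact closure_minimal (fun y hy => (D.f_neg y (abs_lt.mpr hy)).le)
    (isClosed_le D.continuous_f continuous_const) hmem

lemma f_nonneg_of_nonneg_arg {x : ℝ} (h : D.β ≤ x) : 0 ≤ D.f x := by
  have hmem : x ∈ closure (Ioi D.β) := by rw [closure_Ioi]; exact h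
  exact closure_minimal (s := Ioi D.β) (t := {y | 0 ≤ D.f y})
    (fun y hy => (D.f_pos y (lt_of_lt_of_le hy (le_abs_self y))).le)
    (isClosed_le continuous_const D.continuous_f) hmem

lemma f_nonneg {x : ℝ} (h : D.β ≤ |x|) : 0 ≤ D.f x := by
  rcases abs_cases x with ⟨h1, _⟩ | ⟨h1, _⟩
  · exact D.f_nonneg_of_nonneg_arg (h1 ▸ h)
  · rw [← D.f_neg_arg]; exact D.f_nonneg_of_nonneg_arg (h1 ▸ h)

lemma f_mul_level_nonneg (x : ℝ) : 0 ≤ D.f x * D.level x := by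
  rcases le_or_gt |x| D.β with h | h
  · exact mul_nonneg_of_nonpos_of_nonpos (D.f_nonpos h) (D.level_nonpos h)
  · exact mul_nonneg (D.f_nonneg h.le) (D.level_pos h).le

lemma exists_neg_f_le : ∃ C : ℝ, 0 ≤ C ∧ ∀ x, -D.f x ≤ C := by
  obtain ⟨C, hC⟩ := (isCompact_Icc (a := -D.β) (b := D.β)).bddAbove_image
    (f := fun x => -D.f x) D.continuous_f.neg.continuousOn
  refine ⟨max C 0, le_max_right _ _, fun x => ?_⟩
  rcases le_or_gt |x| D.β with h | h
  · exact le_max_of_le_left (hC ⟨x, abs_le.mp h, rfl⟩)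
  · exact le_max_of_le_right (by linarith [D.f_pos x h])

/-! ### Contraction of the half return map. -/

/-- `y` is the graph of an orbit of the Liénard system in the upper half plane that leads from
`(-m, 0)` to `(m', 0)`. -/
structure IsArc (m m' : ℝ) (y : ℝ → ℝ) : Prop where
  β_le : D.β ≤ m
  β_lt : D.β < m'
  continuousOn : ContinuousOn y (Icc (-m) m')
  left : y (-m) = 0
  right : y m' = 0
  pos : ∀ x ∈ Ioo (-m) m', 0 < y x
  hasDerivAt : ∀ x ∈ Ioo (-m) m', HasDerivAt y (-D.f x - D.k * x / y x) x
  energy_pos : ∀ x ∈ Ioo (-m) m', 0 < y x ^ 2 + D.level x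

/-- The square root of the shifted energy along a graph. -/
noncomputable def root (y : ℝ → ℝ) (x : ℝ) : ℝ := √(y x ^ 2 + D.level x)

/-- The square root of the shifted energy at `(m, 0)`. -/
noncomputable def height (m : ℝ) : ℝ := √(D.level m)

lemma continuous_level : Continuous D.level := by unfold level; fun_prop

variable {D}

namespace IsArc

variable {m m' : ℝ} {y : ℝ → ℝ}

lemma continuousOn_root (h : D.IsArc m m' y) : ContinuousOn (D.root y) (Icc (-m) m') :=
  ((h.continuousOn.pow 2).add D.continuous_level.continuousOn).sqrt

lemma root_left (h : D.IsArc m m' y) : D.root y (-m) = D.height m := by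
  rw [root, height, h.left, level_neg_arg, zero_pow two_ne_zero, zero_add]

lemma root_right (h : D.IsArc m m' y) : D.root y m' = D.height m' := by
  rw [root, height, h.right, zero_pow two_ne_zero, zero_add]

lemma root_pos (h : D.IsArc m m' y) {x : ℝ} (hx : x ∈ Ioo (-m) m') : 0 < D.root y x :=
  Real.sqrt_pos.mpr (h.energy_pos x hx)

/-- In the derivative of `y² + level` the restoring terms `∓2 k x` cancel, so only the damping
changes the root and the singular quotient by `y` disappears. -/
lemma hasDerivAt_root (h : D.IsArc m m' y) {x : ℝ} (hx : x ∈ Ioo (-m) m') :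
    HasDerivAt (D.root y) (-D.f x * y x / D.root y x) x := by
  have h1 := h.hasDerivAt x hx
  have h2 : HasDerivAt (fun x => y x ^ 2 + D.level x)
      (2 * y x * (-D.f x - D.k * x / y x) + D.k * (2 * x)) x := by
    have := (h1.pow 2).add (((hasDerivAt_pow 2 x).sub_const (D.β ^ 2)).const_mul D.k)
    simpa using! this
  have h3 : HasDerivAt (D.root y) _ x := h2.sqrt (h.energy_pos x hx).ne'
  have h4 := (h.pos x hx).ne'
  have h5 := (h.root_pos hx).ne'
  convert h3 using 1
  change _ = _ / (2 * D.root y x)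
  field_simp
  ring

lemma strictAntiOn_root (h : D.IsArc m m' y) {a b : ℝ} (ha : -m ≤ a) (hb : b ≤ m')
    (hab : ∀ x ∈ Ioo a b, D.β < |x|) : StrictAntiOn (D.root y) (Icc a b) := by
  refine strictAntiOn_of_deriv_neg (convex_Icc a b)
    (h.continuousOn_root.mono (Icc_subset_Icc ha hb)) fun x hx => ?_
  rw [interior_Icc] at hx
  have hx' : x ∈ Ioo (-m) m' := ⟨by linarith [hx.1], by linarith [hx.2]⟩
  rw [(h.hasDerivAt_root hx').deriv]
  have := mul_pos (D.f_pos x (hab x hx)) (h.pos x hx')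
  exact div_neg_of_neg_of_pos (by linarith) (h.root_pos hx')

lemma strictAntiOn_root_left (h : D.IsArc m m' y) :
    StrictAntiOn (D.root y) (Icc (-m) (-D.β)) :=
  h.strictAntiOn_root le_rfl (by linarith [h.β_lt, D.β_pos]) fun x hx => by
    rw [abs_of_neg (by linarith [hx.2, D.β_pos])]; linarith [hx.2]

lemma strictAntiOn_root_right (h : D.IsArc m m' y) :
    StrictAntiOn (D.root y) (Icc D.β m') :=
  h.strictAntiOn_root (by linarith [h.β_le, D.β_pos]) le_rfl fun x hx => by
    rw [abs_of_pos (by linarith [hx.1, D.β_pos])]; linarith [hx.1]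

lemma height_le_root (_ : D.IsArc m m' y) {x : ℝ} : D.height x ≤ D.root y x :=
  Real.sqrt_le_sqrt (by nlinarith [sq_nonneg (y x)])

/-- The distance between the energy roots of two arcs does not increase along the arcs. -/
lemma abs_root_sub_root_le {m₁ m₁' m₂ m₂' : ℝ} {y₁ y₂ : ℝ → ℝ} (h₁ : D.IsArc m₁ m₁' y₁)
    (h₂ : D.IsArc m₂ m₂' y₂) {a b : ℝ} (hab : a ≤ b) (ha₁ : -m₁ ≤ a) (ha₂ : -m₂ ≤ a)
    (hb₁ : b ≤ m₁') (hb₂ : b ≤ m₂') :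
    |D.root y₂ b - D.root y₁ b| ≤ |D.root y₂ a - D.root y₁ a| := by
  have key : AntitoneOn (fun x => (D.root y₂ x - D.root y₁ x) ^ 2) (Icc a b) := by
    have hd : ∀ x ∈ Ioo a b, HasDerivAt (fun x => (D.root y₂ x - D.root y₁ x) ^ 2)
        (2 * (D.root y₂ x - D.root y₁ x) *
          (-D.f x * y₂ x / D.root y₂ x - -D.f x * y₁ x / D.root y₁ x)) x := by
      intro x hx
      have := ((h₂.hasDerivAt_root (x := x) ⟨by linarith [hx.1], by linarith [hx.2]⟩).sub
        (h₁.hasDerivAt_root (x := x) ⟨by linarith [hx.1], by linarith [hx.2]⟩)).pow 2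
      simpa using! this
    refine antitoneOn_of_deriv_nonpos (convex_Icc a b) ?_ ?_ ?_
    · exact ((h₂.continuousOn_root.mono (Icc_subset_Icc ha₂ hb₂)).sub
        (h₁.continuousOn_root.mono (Icc_subset_Icc ha₁ hb₁))).pow 2
    · rw [interior_Icc]
      exact fun x hx => (hd x hx).differentiableAt.differentiableWithinAt
    · rw [interior_Icc]
      intro x hx
      rw [(hd x hx).deriv]
      have hx₁ : x ∈ Ioo (-m₁) m₁' := ⟨by linarith [hx.1], by linarith [hx.2]⟩
      have hx₂ : x ∈ Ioo (-m₂) m₂' := ⟨by linarith [hx.1], by linarith [hx.2]⟩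
      have e₁ : D.root y₁ x ^ 2 = y₁ x ^ 2 + D.level x := Real.sq_sqrt (h₁.energy_pos x hx₁).le
      have e₂ : D.root y₂ x ^ 2 = y₂ x ^ 2 + D.level x := Real.sq_sqrt (h₂.energy_pos x hx₂).le
      have p₁ := h₁.root_pos hx₁
      have p₂ := h₂.root_pos hx₂
      have q₁ := h₁.pos x hx₁
      have q₂ := h₂.pos x hx₂
      have hfl := D.f_mul_level_nonneg x
      generalize D.root y₁ x = u₁ at *
      generalize D.root y₂ x = u₂ at *
      generalize y₁ x = v₁ at *
      generalize y₂ x = v₂ at *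
      have hS : 0 < v₂ * u₁ + v₁ * u₂ := by positivity
      -- Substituting `v² = u² - level` shows that `v₂ u₁ - v₁ u₂` has the sign of `level * (u₂ -
      -- u₁)`; multiplying by `f` makes it harmless, as `f * level ≥ 0`.
      have hB : (v₂ * u₁ - v₁ * u₂) * (v₂ * u₁ + v₁ * u₂) =
          D.level x * (u₂ - u₁) * (u₂ + u₁) := by
        linear_combination (-u₁ ^ 2) * e₂ + u₂ ^ 2 * e₁
      have h1 : 0 ≤ (D.f x * (u₂ - u₁) * (v₂ * u₁ - v₁ * u₂)) * (v₂ * u₁ + v₁ * u₂) := by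
        have : (D.f x * (u₂ - u₁) * (v₂ * u₁ - v₁ * u₂)) * (v₂ * u₁ + v₁ * u₂) =
            (D.f x * D.level x) * ((u₂ - u₁) ^ 2 * (u₂ + u₁)) := by
          linear_combination (D.f x * (u₂ - u₁)) * hB
        rw [this]; positivity
      have h2 := nonneg_of_mul_nonneg_left h1 hS
      have h3 : 2 * (u₂ - u₁) * (-D.f x * v₂ / u₂ - -D.f x * v₁ / u₁) =
          -(2 * (D.f x * (u₂ - u₁) * (v₂ * u₁ - v₁ * u₂)) / (u₁ * u₂)) := by
        field_simp; ring
      rw [h3]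
      have : 0 ≤ 2 * (D.f x * (u₂ - u₁) * (v₂ * u₁ - v₁ * u₂)) / (u₁ * u₂) := by positivity
      linarith
  exact sq_le_sq.mp (key (left_mem_Icc.mpr hab) (right_mem_Icc.mpr hab) hab)

lemma height_mono {x y : ℝ} (hx : D.β ≤ x) (hxy : x ≤ y) : D.height x ≤ D.height y :=
  Real.sqrt_le_sqrt (D.level_mono hx hxy)

/-- The end heights of two arcs differ by at most the difference of the energy roots at a common
left point. -/
lemma abs_height_sub_height_le_of_common {m₁ m₁' m₂ m₂' : ℝ} {y₁ y₂ : ℝ → ℝ}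
    (h₁ : D.IsArc m₁ m₁' y₁) (h₂ : D.IsArc m₂ m₂' y₂) {a : ℝ} (ha : a ≤ D.β)
    (ha₁ : -m₁ ≤ a) (ha₂ : -m₂ ≤ a) :
    |D.height m₂' - D.height m₁'| ≤ |D.root y₂ a - D.root y₁ a| := by
  wlog hm : m₁' ≤ m₂' generalizing m₁ m₁' m₂ m₂' y₁ y₂
  · rw [abs_sub_comm, abs_sub_comm (D.root y₂ a)]
    exact this h₂ h₁ ha₂ ha₁ (le_of_not_ge hm)
  have h3 := h₁.abs_root_sub_root_le h₂ (ha.trans h₁.β_lt.le) ha₁ ha₂ le_rfl hm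
  -- Beyond `m₁'` only the outer arc is left. Its root still falls, to `height m₂' ≥ height m₁'`, so
  -- the gap at `m₁'` bounds the gap of the end heights.
  have h4 := h₂.strictAntiOn_root_right.antitoneOn ⟨h₁.β_lt.le, hm⟩ (right_mem_Icc.mpr h₂.β_lt.le) hm
  rw [h₂.root_right] at h4
  rw [h₁.root_right] at h3
  have h5 := height_mono (D := D) h₁.β_lt.le hm
  rw [abs_of_nonneg (by linarith)]
  rw [abs_of_nonneg (by linarith)] at h3
  linarith

/-- The half return map strictly contracts height differences. -/
lemma abs_height_sub_height_lt {m₁ m₁' m₂ m₂' : ℝ} {y₁ y₂ : ℝ → ℝ}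
    (h₁ : D.IsArc m₁ m₁' y₁) (h₂ : D.IsArc m₂ m₂' y₂) (hne : m₁ ≠ m₂) :
    |D.height m₂' - D.height m₁'| < |D.height m₂ - D.height m₁| := by
  wlog hm : m₁ < m₂ generalizing m₁ m₁' m₂ m₂' y₁ y₂
  · rw [abs_sub_comm, abs_sub_comm (D.height m₂)]
    exact this h₂ h₁ hne.symm (lt_of_le_of_ne (le_of_not_gt hm) hne.symm)
  have hβ := D.β_pos
  have h3 := h₁.abs_height_sub_height_le_of_common h₂ (a := -m₁) (by linarith [h₁.β_le]) le_rfl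
    (by linarith)
  -- Strictness comes from here: the outer arc loses energy on `[-m₂, -m₁]`, before the inner arc
  -- begins.
  have h4 := h₂.strictAntiOn_root_left (left_mem_Icc.mpr (by linarith [h₁.β_le]))
    ⟨by linarith, neg_le_neg h₁.β_le⟩ (neg_lt_neg hm)
  have h5 : D.height m₁ ≤ D.root y₂ (-m₁) := by
    have := h₂.height_le_root (x := -m₁)
    rwa [height, level_neg_arg] at this
  rw [h₁.root_left] at h3
  rw [h₂.root_left] at h4
  rw [abs_of_nonneg (a := D.root y₂ (-m₁) - _) (by linarith)] at h3
  rw [abs_of_nonneg (by linarith : 0 ≤ D.height m₂ - D.height m₁)]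
  linarith

/-- The graph equation is singular at the end points, where `y = 0`; the contraction estimate from
the common left end replaces ODE uniqueness. -/
lemma height_eq_height {m m₁' m₂' : ℝ} {y₁ y₂ : ℝ → ℝ}
    (h₁ : D.IsArc m m₁' y₁) (h₂ : D.IsArc m m₂' y₂) : D.height m₁' = D.height m₂' := by
  have := h₁.abs_height_sub_height_le_of_common h₂ (a := -m) (by linarith [h₁.β_le, D.β_pos]) le_rfl
    le_rfl
  rw [h₁.root_left, h₂.root_left, sub_self, abs_zero] at this
  linarith [abs_nonpos_iff.mp this]

/-! ### Decrease of large amplitudes. -/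

lemma hasDerivAt_amplitude (h : D.IsArc m m' y) {x : ℝ} (hx : x ∈ Ioo (-m) m') :
    HasDerivAt (fun x => √(y x ^ 2 + D.k * x ^ 2)) (-D.f x * y x / √(y x ^ 2 + D.k * x ^ 2)) x := by
  have hk := D.k_pos
  have h1 := h.hasDerivAt x hx
  have h4 := h.pos x hx
  have h2 : HasDerivAt (fun x => y x ^ 2 + D.k * x ^ 2)
      (2 * y x * (-D.f x - D.k * x / y x) + D.k * (2 * x)) x := by
    have := (h1.pow 2).add ((hasDerivAt_pow 2 x).const_mul D.k)
    simpa using! this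
  have h0 : 0 < y x ^ 2 + D.k * x ^ 2 := by positivity
  convert h2.sqrt h0.ne' using 1
  have h5 := (Real.sqrt_pos.mpr h0).ne'
  field_simp
  ring

lemma continuousOn_amplitude (h : D.IsArc m m' y) :
    ContinuousOn (fun x => √(y x ^ 2 + D.k * x ^ 2)) (Icc (-m) m') :=
  ((h.continuousOn.pow 2).add (by fun_prop)).sqrt

/-- Comparison principle for the amplitude `√(v ^ 2 + k * x ^ 2)` along an arc. -/
lemma amplitude_sub_le (h : D.IsArc m m' y) {G G' : ℝ → ℝ} (hG : ∀ x, HasDerivAt G (G' x) x)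
    {a b : ℝ} (ha : -m ≤ a) (hab : a ≤ b) (hb : b ≤ m')
    (hle : ∀ x ∈ Ioo a b, -D.f x * y x / √(y x ^ 2 + D.k * x ^ 2) ≤ G' x) :
    √(y b ^ 2 + D.k * b ^ 2) - √(y a ^ 2 + D.k * a ^ 2) ≤ G b - G a := by
  have hd : ∀ x ∈ Ioo a b, HasDerivAt (fun x => √(y x ^ 2 + D.k * x ^ 2) - G x)
      (-D.f x * y x / √(y x ^ 2 + D.k * x ^ 2) - G' x) x := fun x hx =>
    (h.hasDerivAt_amplitude ⟨by linarith [hx.1], by linarith [hx.2]⟩).sub (hG x)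
  have key : AntitoneOn (fun x => √(y x ^ 2 + D.k * x ^ 2) - G x) (Icc a b) := by
    refine antitoneOn_of_deriv_nonpos (convex_Icc a b) ?_ ?_ ?_
    · exact (h.continuousOn_amplitude.mono (Icc_subset_Icc ha hb)).sub
        fun x _ => (hG x).continuousAt.continuousWithinAt
    · rw [interior_Icc]
      exact fun x hx => (hd x hx).differentiableAt.differentiableWithinAt
    · rw [interior_Icc]
      intro x hx
      rw [(hd x hx).deriv]
      linarith [hle x hx]
  have := key (left_mem_Icc.mpr hab) (right_mem_Icc.mpr hab) hab
  simp only at this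
  linarith

lemma amplitude_anti (h : D.IsArc m m' y) {a b : ℝ} (ha : -m ≤ a) (hab : a ≤ b) (hb : b ≤ m')
    (hf : ∀ x ∈ Ioo a b, D.β ≤ |x|) :
    √(y b ^ 2 + D.k * b ^ 2) ≤ √(y a ^ 2 + D.k * a ^ 2) := by
  have := h.amplitude_sub_le (G := fun _ => 0) (fun x => hasDerivAt_const x 0) ha hab hb
    fun x hx => ?_
  · linarith
  have h1 := D.f_nonneg (hf x hx)
  have h2 := h.pos x ⟨by linarith [hx.1], by linarith [hx.2]⟩
  have : 0 ≤ D.f x * y x / √(y x ^ 2 + D.k * x ^ 2) := by positivity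
  rw [neg_mul, neg_div]; linarith

end IsArc

/-- The half return map decreases large amplitudes. -/
lemma exists_forall_isArc_le (D : LienardSystem) :
    ∃ M, D.β ≤ M ∧ ∀ m m' y, D.IsArc m m' y → M ≤ m → m' ≤ m := by
  obtain ⟨C, hC0, hC⟩ := D.exists_neg_f_le
  obtain ⟨A, hA⟩ := (isCompact_Icc (a := -D.r) (b := D.r)).bddAbove_image
    D.continuous_f.continuousOn
  have hk := D.k_pos
  have hβ := D.β_pos
  have hr := D.β_lt_r
  have hr0 : 0 < D.r := hβ.trans hr
  have hF := D.F_r_pos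
  have hA' : ∀ x ∈ Icc (-D.r) D.r, D.f x ≤ A := fun x hx => hA ⟨x, hx, rfl⟩
  have hA0 : 0 < A := (D.f_pos D.r (by rwa [abs_of_pos hr0])).trans_le
    (hA' D.r (right_mem_Icc.mpr (by linarith)))
  set B := A * D.k * D.r ^ 2 with hB
  have hB0 : 0 < B := by positivity
  -- Chosen so that on `[-r, r]` an amplitude that stays above `ρ` changes by at most `2 B r / ρ² -
  -- 2 F r ≤ 0`.
  set ρ := max 1 (B * D.r / D.F D.r) with hρ
  have hρ1 : 1 ≤ ρ := le_max_left _ _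
  have hρ2 : B * D.r / ρ ^ 2 ≤ D.F D.r := by
    have h1 : B * D.r / D.F D.r ≤ ρ ^ 2 := (le_max_right _ _).trans (by nlinarith)
    rw [div_le_iff₀ (by positivity)]
    rwa [div_le_iff₀' hF] at h1
  -- The second bound covers arcs whose amplitude drops below `ρ` inside the strip: from there to `x
  -- = r` it grows by at most `2 C r`, the slope being at most `C`.
  refine ⟨max D.r ((ρ + 2 * C * D.r) / √D.k), hr.le.trans (le_max_left _ _), ?_⟩
  intro m m' y h hm
  by_contra! hlt
  have hm1 : D.r ≤ m := (le_max_left _ _).trans hm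
  have hm2 : ρ + 2 * C * D.r ≤ √D.k * m := by
    have := (le_max_right _ _).trans hm
    rwa [div_le_iff₀' (Real.sqrt_pos.mpr hk)] at this
  have eend : √(y m' ^ 2 + D.k * m' ^ 2) = √D.k * m' := by
    rw [h.right, zero_pow two_ne_zero, zero_add, Real.sqrt_mul hk.le,
      Real.sqrt_sq (by linarith)]
  have estart : √(y (-m) ^ 2 + D.k * (-m) ^ 2) = √D.k * m := by
    rw [h.left, zero_pow two_ne_zero, zero_add, Real.sqrt_mul hk.le, neg_sq,
      Real.sqrt_sq (by linarith)]
  have hright := h.amplitude_anti (a := D.r) (b := m') (by linarith) (by linarith) le_rfl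
    fun x hx => by rw [abs_of_pos (by linarith [hx.1])]; linarith [hx.1]
  have hleft := h.amplitude_anti (a := -m) (b := -D.r) le_rfl (by linarith) (by linarith)
    fun x hx => by rw [abs_of_neg (by linarith [hx.2])]; linarith [hx.2]
  have hkm : √D.k * m < √D.k * m' := mul_lt_mul_of_pos_left hlt (Real.sqrt_pos.mpr hk)
  rw [eend] at hright
  rw [estart] at hleft
  by_cases hex : ∃ a ∈ Icc (-D.r) D.r, √(y a ^ 2 + D.k * a ^ 2) < ρ
  · obtain ⟨a, ha, hlt'⟩ := hex
    have := h.amplitude_sub_le (G := fun x => C * x) (G' := fun _ => C)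
      (fun x => by simpa using! (hasDerivAt_id x).const_mul C) (a := a) (b := D.r)
      (by linarith [ha.1]) ha.2 (by linarith) fun x hx => ?_
    · nlinarith [ha.1]
    have h1 := h.pos x ⟨by linarith [hx.1, ha.1], by linarith [hx.2]⟩
    have h0 : 0 < √(y x ^ 2 + D.k * x ^ 2) := Real.sqrt_pos.mpr (by positivity)
    have h2 : y x ≤ √(y x ^ 2 + D.k * x ^ 2) := Real.le_sqrt_of_sq_le (by nlinarith [sq_nonneg x])
    rw [div_le_iff₀ h0]
    exact (mul_le_mul_of_nonneg_right (hC x) h1.le).trans (mul_le_mul_of_nonneg_left h2 hC0)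
  · push Not at hex
    have := h.amplitude_sub_le (G := fun x => B / ρ ^ 2 * x - D.F x)
      (G' := fun x => B / ρ ^ 2 - D.f x)
      (fun x => by simpa using! ((hasDerivAt_id x).const_mul (B / ρ ^ 2)).sub (D.hasDerivAt_F x))
      (a := -D.r) (b := D.r) (by linarith) (by linarith) (by linarith) fun x hx => ?_
    · simp only [D.F_neg_arg] at this
      have h1 : B / ρ ^ 2 * D.r = B * D.r / ρ ^ 2 := by ring
      linarith
    have h1 := h.pos x ⟨by linarith [hx.1], by linarith [hx.2]⟩
    have hρx := hex x ⟨hx.1.le, hx.2.le⟩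
    have hsq : √(y x ^ 2 + D.k * x ^ 2) ^ 2 = y x ^ 2 + D.k * x ^ 2 :=
      Real.sq_sqrt (by positivity)
    have h2 : y x ≤ √(y x ^ 2 + D.k * x ^ 2) := Real.le_sqrt_of_sq_le (by nlinarith [sq_nonneg x])
    have hBρ : 0 ≤ B / ρ ^ 2 := by positivity
    generalize √(y x ^ 2 + D.k * x ^ 2) = R at *
    have hR0 : 0 < R := by linarith
    rcases le_total (D.f x) 0 with hf | hf
    · rw [div_le_iff₀ hR0]
      have h3 := mul_nonneg hBρ hR0.le
      have h4 := mul_le_mul_of_nonneg_left h2 (neg_nonneg.mpr hf)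
      linarith
    -- The amplitude slope is nearly `-f` for large `R`: from `y ≤ R` one gets `R² - y R ≤ R² - y² =
    -- k x²`.
    · have h3 : 1 - y x / R ≤ D.k * D.r ^ 2 / ρ ^ 2 := by
        have h4 : 1 - y x / R ≤ D.k * x ^ 2 / R ^ 2 := by
          rw [le_div_iff₀ (by positivity)]
          have e : (1 - y x / R) * R ^ 2 = R ^ 2 - y x * R := by field_simp
          have := mul_le_mul_of_nonneg_left h2 h1.le
          linarith
        have hx2 : x ^ 2 ≤ D.r ^ 2 := sq_le_sq' hx.1.le hx.2.le
        refine h4.trans ?_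
        gcongr
      have h5 : D.f x * (1 - y x / R) ≤ A * (D.k * D.r ^ 2 / ρ ^ 2) :=
        (mul_le_mul_of_nonneg_left h3 hf).trans
          (mul_le_mul_of_nonneg_right (hA' x ⟨hx.1.le, hx.2.le⟩) (by positivity))
      have h6 : A * (D.k * D.r ^ 2 / ρ ^ 2) = B / ρ ^ 2 := by rw [hB]; ring
      rw [h6] at h5
      calc -D.f x * y x / R = D.f x * (1 - y x / R) - D.f x := by ring
        _ ≤ B / ρ ^ 2 - D.f x := sub_le_sub_right h5 _

/-! ### Fixed point of the half return map. -/

lemma height_lt_height {m₁ m₂ : ℝ} (h₁ : D.β ≤ m₁) (h : m₁ < m₂) : D.height m₁ < D.height m₂ := by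
  refine Real.sqrt_lt_sqrt (D.level_nonneg h₁) ?_
  have h1 := D.β_pos
  have h2 := D.k_pos
  have h3 : 0 ≤ m₁ := h1.le.trans h₁
  unfold level; gcongr

lemma height_injOn : InjOn D.height (Ici D.β) := by
  intro m₁ h₁ m₂ h₂ h
  rcases lt_trichotomy m₁ m₂ with h' | h' | h'
  · exact absurd h (height_lt_height h₁ h').ne
  · exact h'
  · exact absurd h (height_lt_height h₂ h').ne'

lemma exists_height_eq {w : ℝ} (hw : 0 ≤ w) : ∃ m, D.β ≤ m ∧ D.height m = w := by
  have hk := D.k_pos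
  refine ⟨√(D.β ^ 2 + w ^ 2 / D.k), Real.le_sqrt_of_sq_le (by
    have : 0 ≤ w ^ 2 / D.k := by positivity
    linarith), ?_⟩
  rw [height, level, Real.sq_sqrt (by positivity), add_sub_cancel_left, mul_div_cancel₀ _ hk.ne',
    Real.sqrt_sq hw]

/-- If the half return map is everywhere defined, then it has a fixed point. -/
lemma exists_isArc_self (hex : ∀ m, D.β ≤ m → ∃ m' y, D.IsArc m m' y) :
    ∃ m y, D.IsArc m m y := by
  obtain ⟨M, hM, hM'⟩ := D.exists_forall_isArc_le
  choose! μ hμ hμh using fun w (hw : 0 ≤ w) => D.exists_height_eq hw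
  choose! Q y hQ using hex
  -- The half return map in the height coordinate, with `μ` the inverse of the height on `[β, ∞)`.
  -- There the contraction reads as a Lipschitz bound, so continuity is free.
  set g : ℝ → ℝ := fun w => D.height (Q (μ w)) with hg
  have hlip : LipschitzOnWith 1 g (Ici 0) := by
    refine LipschitzOnWith.of_dist_le_mul fun w₁ h₁ w₂ h₂ => ?_
    rw [Real.dist_eq, Real.dist_eq, NNReal.coe_one, one_mul]
    rcases eq_or_ne w₁ w₂ with rfl | hne
    · simp
    have hne' : μ w₂ ≠ μ w₁ := fun h => hne (by rw [← hμh w₁ h₁, ← hμh w₂ h₂, h])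
    have := (hQ _ (hμ w₂ h₂)).abs_height_sub_height_lt (hQ _ (hμ w₁ h₁)) hne'
    rw [hμh w₁ h₁, hμh w₂ h₂] at this
    exact this.le
  have hw0 : 0 ≤ D.height M := Real.sqrt_nonneg _
  have hcont : ContinuousOn (fun w => g w - w) (Icc 0 (D.height M)) :=
    (hlip.continuousOn.mono Icc_subset_Ici_self).sub continuousOn_id
  have hμM : μ (D.height M) = M := height_injOn (hμ _ hw0) hM (hμh _ hw0)
  have hend : g (D.height M) - D.height M ≤ 0 := by
    have h1 := hM' _ _ _ (hQ M hM) le_rfl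
    have h2 := IsArc.height_mono (D := D) (hQ M hM).β_lt.le h1
    simp only [hg, hμM]
    linarith
  have hstart : 0 ≤ g 0 - 0 := by rw [sub_zero]; exact Real.sqrt_nonneg _
  obtain ⟨w, hw, hgw⟩ := intermediate_value_Icc' hw0 hcont ⟨hend, hstart⟩
  have h1 := hQ _ (hμ w hw.1)
  have h2 : Q (μ w) = μ w := height_injOn h1.β_lt.le (hμ w hw.1) (by
    rw [hμh w hw.1]; simpa [hg, sub_eq_zero] using hgw)
  exact ⟨μ w, y (μ w), by rwa [h2] at h1⟩

end LienardSystem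

/-! ### Forward solutions: bounds, uniqueness and global existence. -/

lemma PlanarFlow.IsForwardSolution.hasDerivAt {V : Type*} [NormedAddCommGroup V] [NormedSpace ℝ V]
    {X : V → V} {z : ℝ → V} (hz : IsForwardSolution X z) {t : ℝ} (ht : 0 < t) :
    HasDerivAt z (X (z t)) t :=
  (hz t ht.le).hasDerivAt (Ici_mem_nhds ht)

lemma PlanarFlow.IsForwardSolution.shift {V : Type*} [NormedAddCommGroup V] [NormedSpace ℝ V]
    {X : V → V} {z : ℝ → V} (hz : IsForwardSolution X z) {s : ℝ} (hs : 0 ≤ s) :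
    IsForwardSolution X (fun t => z (t + s)) := by
  intro t ht
  have h1 : HasDerivWithinAt (fun t : ℝ => t + s) 1 (Ici 0) t :=
    ((hasDerivAt_id t).add_const s).hasDerivWithinAt
  have h2 := (hz (t + s) (add_nonneg ht hs)).scomp t h1
    (fun u (hu : 0 ≤ u) => add_nonneg hu hs)
  simpa using! h2

lemma IsIntegralCurve.isForwardSolution_shift {V : Type*} [NormedAddCommGroup V] [NormedSpace ℝ V]
    {X : V → V} {z : ℝ → V} (hz : IsIntegralCurve z (fun _ => X)) (s : ℝ) :
    IsForwardSolution X (fun t => z (t + s)) := by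
  intro t _
  have h1 : HasDerivAt (fun t : ℝ => t + s) 1 t := (hasDerivAt_id t).add_const s
  have h2 := ((hz (t + s)).scomp t h1).hasDerivWithinAt (s := Ici 0)
  simpa using! h2

namespace LienardSystem

variable (D : LienardSystem)

lemma contDiff_field : ContDiff ℝ 1 D.field := by
  have := D.contDiff_f
  unfold field
  fun_prop

lemma field_neg_arg (p : ℝ × ℝ) : D.field (-p) = -D.field p := by
  ext <;> simp [field, D.f_neg_arg]; ring

/-- The energy `v ^ 2 + k * x ^ 2`. -/
def energy (p : ℝ × ℝ) : ℝ := p.2 ^ 2 + D.k * p.1 ^ 2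

lemma norm_le_of_energy_le {p : ℝ × ℝ} {e : ℝ} (h : D.energy p ≤ e) :
    ‖p‖ ≤ max √(e / D.k) √e := by
  have hk := D.k_pos
  unfold energy at h
  rw [Prod.norm_def]
  refine max_le_max ?_ ?_
  · rw [Real.norm_eq_abs]
    refine Real.abs_le_sqrt ?_
    rw [le_div_iff₀' hk]
    nlinarith [sq_nonneg p.2]
  · rw [Real.norm_eq_abs]
    refine Real.abs_le_sqrt ?_
    nlinarith [sq_nonneg p.1]

/-- Along solutions of the system, slowed down by a factor in `[0, 1]`, the energy grows at most
exponentially. -/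
lemma exists_energy_le : ∃ C : ℝ, 0 ≤ C ∧ ∀ (χ : ℝ × ℝ → ℝ) (T : ℝ) (z : ℝ → ℝ × ℝ),
    (∀ p, 0 ≤ χ p) → (∀ p, χ p ≤ 1) →
    IsIntegralCurveOn z (fun _ p => χ p • D.field p) (Icc 0 T) →
    ∀ t ∈ Icc 0 T, D.energy (z t) ≤ D.energy (z 0) * Real.exp (C * t) := by
  obtain ⟨C, hC0, hC⟩ := D.exists_neg_f_le
  refine ⟨2 * C, by positivity, fun χ T z hχ0 hχ1 hz t ht => ?_⟩
  have hk := D.k_pos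
  have hd : ∀ s ∈ Icc 0 T, HasDerivWithinAt
      (fun s => D.energy (z s) * Real.exp (-(2 * C) * s))
      ((-2 * χ (z s) * D.f (z s).1 * (z s).2 ^ 2 - 2 * C * D.energy (z s)) *
        Real.exp (-(2 * C) * s)) (Icc 0 T) s := by
    intro s hs
    have h0 := hz s hs
    have h1 : HasDerivWithinAt (fun s => (z s).1) (χ (z s) * (z s).2) (Icc 0 T) s := by
      simpa [field] using! (hasFDerivAt_fst.comp_hasDerivWithinAt s h0)
    have h2 : HasDerivWithinAt (fun s => (z s).2)
        (χ (z s) * (-D.f (z s).1 * (z s).2 - D.k * (z s).1)) (Icc 0 T) s := by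
      simpa [field] using! (hasFDerivAt_snd.comp_hasDerivWithinAt s h0)
    have h3 := (h2.pow 2).add ((h1.pow 2).const_mul D.k)
    have h4 : HasDerivWithinAt (fun s => Real.exp (-(2 * C) * s))
        (Real.exp (-(2 * C) * s) * (-(2 * C))) (Icc 0 T) s := by
      simpa using ((hasDerivAt_id s).const_mul (-(2 * C))).exp.hasDerivWithinAt
    refine (h3.mul h4).congr_deriv ?_
    simp only [energy, Pi.add_apply, Pi.pow_apply]
    push_cast
    ring
  have hanti : AntitoneOn (fun s => D.energy (z s) * Real.exp (-(2 * C) * s)) (Icc 0 T) := by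
    refine antitoneOn_of_deriv_nonpos (convex_Icc 0 T)
      (fun s hs => (hd s hs).continuousWithinAt) (fun s hs => ?_) (fun s hs => ?_)
    · exact ((hd s (interior_subset hs)).mono interior_subset).differentiableWithinAt
    · rw [((hd s (interior_subset hs)).hasDerivAt (mem_interior_iff_mem_nhds.mp hs)).deriv]
      refine mul_nonpos_of_nonpos_of_nonneg ?_ (Real.exp_nonneg _)
      have h2 := hχ0 (z s)
      have h3 := hχ1 (z s)
      have h4 := hC (z s).1
      have h5 : χ (z s) * -D.f (z s).1 ≤ C := by
        rcases le_total (D.f (z s).1) 0 with h | h <;> nlinarith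
      have h6 : χ (z s) * -D.f (z s).1 * (z s).2 ^ 2 ≤ C * (z s).2 ^ 2 :=
        mul_le_mul_of_nonneg_right h5 (sq_nonneg _)
      have h7 : 0 ≤ C * (D.k * (z s).1 ^ 2) := by positivity
      unfold energy
      linarith
  have h0 := hanti (left_mem_Icc.mpr (ht.1.trans ht.2)) ht ht.1
  simp only [mul_zero, Real.exp_zero, mul_one] at h0
  have h1 : Real.exp (-(2 * C) * t) * Real.exp (2 * C * t) = 1 := by
    rw [← Real.exp_add]; simp
  calc D.energy (z t) = D.energy (z t) * Real.exp (-(2 * C) * t) * Real.exp (2 * C * t) := by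
        rw [mul_assoc, h1, mul_one]
    _ ≤ D.energy (z 0) * Real.exp (2 * C * t) := by gcongr

/-- A priori bound for solutions on bounded time intervals. -/
lemma exists_norm_le (R S : ℝ) : ∃ R' : ℝ, 0 < R' ∧ ∀ (χ : ℝ × ℝ → ℝ) (T : ℝ) (z : ℝ → ℝ × ℝ),
    (∀ p, 0 ≤ χ p) → (∀ p, χ p ≤ 1) → T ≤ S →
    IsIntegralCurveOn z (fun _ p => χ p • D.field p) (Icc 0 T) → ‖z 0‖ ≤ R →
    ∀ t ∈ Icc 0 T, ‖z t‖ ≤ R' := by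
  obtain ⟨C, hC0, hC⟩ := D.exists_energy_le
  have hk := D.k_pos
  set e := (R ^ 2 + D.k * R ^ 2) * Real.exp (C * S)
  refine ⟨max √(e / D.k) √e + 1, by positivity, fun χ T z hχ0 hχ1 hTS hz h0 t ht => ?_⟩
  refine (D.norm_le_of_energy_le (e := e) ((hC χ T z hχ0 hχ1 hz t ht).trans ?_)).trans
    (by linarith)
  have h1 : (z 0).1 ^ 2 ≤ R ^ 2 := by
    rw [← sq_abs]; exact pow_le_pow_left₀ (abs_nonneg _) ((norm_fst_le (z 0)).trans h0) 2
  have h2 : (z 0).2 ^ 2 ≤ R ^ 2 := by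
    rw [← sq_abs]; exact pow_le_pow_left₀ (abs_nonneg _) ((norm_snd_le (z 0)).trans h0) 2
  have h3 : t ≤ S := ht.2.trans hTS
  unfold energy
  show _ ≤ (R ^ 2 + D.k * R ^ 2) * Real.exp (C * S)
  gcongr

/-- Solutions on bounded time intervals depend Lipschitz continuously on the initial value. -/
lemma exists_dist_le (R S : ℝ) : ∃ L : ℝ, 0 < L ∧ ∀ (T : ℝ) (z₁ z₂ : ℝ → ℝ × ℝ), T ≤ S →
    IsIntegralCurveOn z₁ (fun _ => D.field) (Icc 0 T) →
    IsIntegralCurveOn z₂ (fun _ => D.field) (Icc 0 T) → ‖z₁ 0‖ ≤ R → ‖z₂ 0‖ ≤ R →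
    ∀ t ∈ Icc 0 T, dist (z₁ t) (z₂ t) ≤ L * dist (z₁ 0) (z₂ 0) := by
  obtain ⟨R', hR', hb⟩ := D.exists_norm_le R S
  obtain ⟨K, hK⟩ := (D.contDiff_field.locallyLipschitz.locallyLipschitzOn
    (s := Metric.closedBall 0 R')).exists_lipschitzOnWith_of_compact (isCompact_closedBall 0 R')
  refine ⟨Real.exp (K * S), Real.exp_pos _, fun T z₁ z₂ hTS h₁ h₂ hR₁ hR₂ t ht => ?_⟩
  have hmem : ∀ z : ℝ → ℝ × ℝ, IsIntegralCurveOn z (fun _ => D.field) (Icc 0 T) → ‖z 0‖ ≤ R →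
      ∀ s ∈ Ico 0 T, z s ∈ Metric.closedBall (0 : ℝ × ℝ) R' := fun z hz h0 s hs => by
    rw [mem_closedBall_zero_iff]
    exact hb (fun _ => 1) T z (by simp) (by simp) hTS (by simpa using hz) h0 s ⟨hs.1, hs.2.le⟩
  have hder : ∀ z : ℝ → ℝ × ℝ, IsIntegralCurveOn z (fun _ => D.field) (Icc 0 T) →
      ∀ s ∈ Ico 0 T, HasDerivWithinAt z (D.field (z s)) (Ici s) s := fun z hz s hs =>
    (hz s ⟨hs.1, hs.2.le⟩).mono_of_mem_nhdsWithin
      (mem_of_superset (Icc_mem_nhdsGE hs.2) (Icc_subset_Icc_left hs.1))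
  have := dist_le_of_trajectories_ODE_of_mem (v := fun _ => D.field)
    (s := fun _ => Metric.closedBall 0 R') (K := K) (fun _ _ => hK) h₁.continuousOn
    (hder z₁ h₁) (hmem z₁ h₁ hR₁) h₂.continuousOn (hder z₂ h₂) (hmem z₂ h₂ hR₂) le_rfl t ht
  rw [mul_comm]
  refine this.trans (mul_le_mul_of_nonneg_left (Real.exp_le_exp.mpr ?_) dist_nonneg)
  rw [sub_zero]
  exact mul_le_mul_of_nonneg_left (ht.2.trans hTS) K.2

lemma eqOn_of_isIntegralCurveOn {T : ℝ} {z₁ z₂ : ℝ → ℝ × ℝ}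
    (h₁ : IsIntegralCurveOn z₁ (fun _ => D.field) (Icc 0 T))
    (h₂ : IsIntegralCurveOn z₂ (fun _ => D.field) (Icc 0 T)) (h : z₁ 0 = z₂ 0) :
    EqOn z₁ z₂ (Icc 0 T) := by
  intro t ht
  obtain ⟨L, -, hL⟩ := D.exists_dist_le ‖z₁ 0‖ T
  have := hL T z₁ z₂ le_rfl h₁ h₂ le_rfl (by rw [h]) t ht
  rw [h, dist_self, mul_zero] at this
  exact dist_le_zero.mp this

/-- Forward uniqueness. -/
lemma eq_of_isForwardSolution {z₁ z₂ : ℝ → ℝ × ℝ} (h₁ : IsForwardSolution D.field z₁)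
    (h₂ : IsForwardSolution D.field z₂) (h : z₁ 0 = z₂ 0) {t : ℝ} (ht : 0 ≤ t) : z₁ t = z₂ t :=
  D.eqOn_of_isIntegralCurveOn (T := t) (IsIntegralCurveOn.mono h₁ Icc_subset_Ici_self)
    (IsIntegralCurveOn.mono h₂ Icc_subset_Ici_self) h ⟨ht, le_rfl⟩

/-- A cut-off makes the field bounded, so Picard–Lindelöf reaches time `T` in one step. The a priori
bound holds for every cut-off with values in `[0, 1]`, so the solution never leaves the ball where
the cut-off is `1`. -/
lemma exists_isIntegralCurveOn_Icc (p : ℝ × ℝ) {T : ℝ} (hT : 0 ≤ T) :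
    ∃ z : ℝ → ℝ × ℝ, z 0 = p ∧ IsIntegralCurveOn z (fun _ => D.field) (Icc 0 T) := by
  obtain ⟨R, hR, hb⟩ := D.exists_norm_le ‖p‖ T
  let χ : ContDiffBump (0 : ℝ × ℝ) := ⟨R, R + 1, hR, by linarith⟩
  have hsm : ContDiff ℝ 1 (fun q => χ q • D.field q) := χ.contDiff.smul D.contDiff_field
  have hcs : HasCompactSupport (fun q => χ q • D.field q) := χ.hasCompactSupport.smul_right
  obtain ⟨B, hB⟩ := hcs.exists_bound_of_continuous hsm.continuous
  have hB0 : 0 ≤ B := (norm_nonneg _).trans (hB 0)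
  lift B to NNReal using hB0
  lift T to NNReal using hT
  obtain ⟨K, hK⟩ := (hsm.locallyLipschitz.locallyLipschitzOn
    (s := Metric.closedBall p (B * T))).exists_lipschitzOnWith_of_compact
      (isCompact_closedBall p _)
  have hpl : IsPicardLindelof (fun _ q => χ q • D.field q) (tmin := 0) (tmax := T)
      ⟨0, le_rfl, T.2⟩ p (B * T) 0 B K :=
    IsPicardLindelof.of_time_independent (fun q _ => hB q) hK (by simp)
  obtain ⟨z, hz0, hz⟩ := hpl.exists_eq_forall_mem_Icc_hasDerivWithinAt₀
  refine ⟨z, hz0, fun t ht => ?_⟩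
  have h1 := hb χ T z (fun _ => χ.nonneg) (fun _ => χ.le_one) le_rfl hz (by rw [← hz0]) t ht
  have h2 : χ (z t) = 1 := χ.one_of_mem_closedBall (mem_closedBall_zero_iff.mpr h1)
  have h3 := hz t ht
  rwa [h2, one_smul] at h3

/-- Forward global existence. -/
lemma exists_isForwardSolution (p : ℝ × ℝ) :
    ∃ z : ℝ → ℝ × ℝ, IsForwardSolution D.field z ∧ z 0 = p := by
  choose! z hz0 hz using fun (T : ℝ) (hT : 0 ≤ T) => D.exists_isIntegralCurveOn_Icc p hT
  -- Each time uses a solution that lives one unit longer, so that a relative neighbourhood of `t`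
  -- in `[0, ∞)` lies in its domain.
  refine ⟨fun t => z (t + 1) t, fun t (ht : 0 ≤ t) => ?_, hz0 _ (by norm_num)⟩
  have heq : ∀ s ∈ Ico 0 (t + 1), z (s + 1) s = z (t + 1) s := by
    intro s hs
    refine D.eqOn_of_isIntegralCurveOn (T := s)
      ((hz (s + 1) (by linarith [hs.1])).mono (Icc_subset_Icc_right (by linarith)))
      ((hz (t + 1) (by linarith)).mono (Icc_subset_Icc_right hs.2.le)) ?_ ⟨hs.1, le_rfl⟩
    rw [hz0 _ (by linarith [hs.1]), hz0 _ (by linarith)]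
  have hmem : Ico 0 (t + 1) ∈ 𝓝[Ici 0] t := by
    rw [← Ici_inter_Iio]
    exact inter_mem self_mem_nhdsWithin (mem_nhdsWithin_of_mem_nhds (Iio_mem_nhds (by linarith)))
  have h1 := hz (t + 1) (by linarith) t ⟨ht, by linarith⟩
  have h2 : HasDerivWithinAt (z (t + 1)) (D.field (z (t + 1) t)) (Ici 0) t :=
    h1.mono_of_mem_nhdsWithin (mem_of_superset hmem Ico_subset_Icc_self)
  exact h2.congr_of_eventuallyEq (eventually_of_mem hmem heq) rfl

variable {D} {z : ℝ → ℝ × ℝ}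

lemma neg_isForwardSolution (hz : IsForwardSolution D.field z) :
    IsForwardSolution D.field (fun t => -z t) := by
  intro t ht
  simp only [field_neg_arg]
  exact (hz t ht).neg

lemma hasDerivAt_fst (hz : IsForwardSolution D.field z) {t : ℝ} (ht : 0 < t) :
    HasDerivAt (fun t => (z t).1) (z t).2 t := by
  simpa [field] using! (hasFDerivAt_fst.comp_hasDerivAt t (hz.hasDerivAt ht))

lemma hasDerivAt_snd (hz : IsForwardSolution D.field z) {t : ℝ} (ht : 0 < t) :
    HasDerivAt (fun t => (z t).2) (-D.f (z t).1 * (z t).2 - D.k * (z t).1) t := by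
  simpa [field] using! (hasFDerivAt_snd.comp_hasDerivAt t (hz.hasDerivAt ht))

lemma continuousOn_fst (hz : IsForwardSolution D.field z) :
    ContinuousOn (fun t => (z t).1) (Ici 0) :=
  (IsIntegralCurveOn.continuousOn hz).fst

lemma continuousOn_snd (hz : IsForwardSolution D.field z) :
    ContinuousOn (fun t => (z t).2) (Ici 0) :=
  (IsIntegralCurveOn.continuousOn hz).snd

end LienardSystem

/-! ### Half turns through the upper half plane. -/

lemma mul_sub_le_of_le_hasDerivAt {g g' : ℝ → ℝ} {a b c : ℝ} (hab : a ≤ b)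
    (hc : ContinuousOn g (Icc a b)) (hd : ∀ t ∈ Ioo a b, HasDerivAt g (g' t) t)
    (hle : ∀ t ∈ Ioo a b, c ≤ g' t) : c * (b - a) ≤ g b - g a := by
  refine (convex_Icc a b).mul_sub_le_image_sub_of_le_deriv hc ?_ ?_ a (left_mem_Icc.mpr hab) b
    (right_mem_Icc.mpr hab) hab
  · rw [interior_Icc]
    exact fun t ht => (hd t ht).differentiableAt.differentiableWithinAt
  · rw [interior_Icc]
    exact fun t ht => (hd t ht).deriv ▸ hle t ht

lemma sub_le_mul_of_hasDerivAt_le {g g' : ℝ → ℝ} {a b c : ℝ} (hab : a ≤ b)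
    (hc : ContinuousOn g (Icc a b)) (hd : ∀ t ∈ Ioo a b, HasDerivAt g (g' t) t)
    (hle : ∀ t ∈ Ioo a b, g' t ≤ c) : g b - g a ≤ c * (b - a) := by
  have := mul_sub_le_of_le_hasDerivAt (g := fun t => -g t) (g' := fun t => -g' t) (c := -c) hab
    hc.neg (fun t ht => (hd t ht).neg) (fun t ht => neg_le_neg (hle t ht))
  linarith

/-- Gives the sign of `v` just after, or just before, a zero at which its derivative is positive. -/
lemma HasDerivWithinAt.eventually_div_pos {g : ℝ → ℝ} {c a : ℝ} {s : Set ℝ}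
    (h : HasDerivWithinAt g c s a) (hc : 0 < c) (ha : g a = 0) :
    ∀ᶠ t in 𝓝[s \ {a}] a, 0 < g t / (t - a) := by
  filter_upwards [(hasDerivWithinAt_iff_tendsto_slope.mp h).eventually (lt_mem_nhds hc)] with t ht
  simpa [slope_def_field, ha] using ht

namespace LienardSystem

variable {D : LienardSystem} {z : ℝ → ℝ × ℝ}

lemma continuous_shiftedEnergy (D : LienardSystem) : Continuous D.shiftedEnergy := by
  have := D.continuous_level
  unfold shiftedEnergy; fun_prop

lemma hasDerivAt_shiftedEnergy (hz : IsForwardSolution D.field z) {t : ℝ} (ht : 0 < t) :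
    HasDerivAt (fun t => D.shiftedEnergy (z t)) (-2 * D.f (z t).1 * (z t).2 ^ 2) t := by
  have h := ((hasDerivAt_snd hz ht).pow 2).add
    ((((hasDerivAt_fst hz ht).pow 2).sub_const (D.β ^ 2)).const_mul D.k)
  refine h.congr_deriv ?_
  simp
  ring

lemma continuousOn_shiftedEnergy (hz : IsForwardSolution D.field z) :
    ContinuousOn (fun t => D.shiftedEnergy (z t)) (Ici 0) :=
  D.continuous_shiftedEnergy.comp_continuousOn (IsIntegralCurveOn.continuousOn hz)

/-- The Liénard variable `v + F x` has derivative `-k * x`. -/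
lemma hasDerivAt_lienardVariable (hz : IsForwardSolution D.field z) {t : ℝ} (ht : 0 < t) :
    HasDerivAt (fun t => (z t).2 + D.F (z t).1) (-D.k * (z t).1) t := by
  have h := (hasDerivAt_snd hz ht).add
    ((D.hasDerivAt_F (z t).1).comp t (hasDerivAt_fst hz ht))
  refine h.congr_deriv ?_
  ring

lemma continuousOn_lienardVariable (hz : IsForwardSolution D.field z) :
    ContinuousOn (fun t => (z t).2 + D.F (z t).1) (Ici 0) :=
  (continuousOn_snd hz).add ((continuous_iff_continuousAt.mpr fun x =>
    (D.hasDerivAt_F x).continuousAt).comp_continuousOn (continuousOn_fst hz))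

lemma Icc_subset_Ici_zero {a b : ℝ} (ha : 0 ≤ a) : Icc a b ⊆ Ici 0 :=
  fun _ ht => ha.trans ht.1

lemma strictMonoOn_fst (hz : IsForwardSolution D.field z) {a b : ℝ} (ha : 0 ≤ a)
    (hpos : ∀ t ∈ Ioo a b, 0 < (z t).2) : StrictMonoOn (fun t => (z t).1) (Icc a b) := by
  refine strictMonoOn_of_deriv_pos (convex_Icc a b)
    ((continuousOn_fst hz).mono (Icc_subset_Ici_zero ha)) fun t ht => ?_
  rw [interior_Icc] at ht
  rw [(hasDerivAt_fst hz (ha.trans_lt ht.1)).deriv]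
  exact hpos t ht

/-- On an orbit that starts on or outside the zero set of the shifted energy and moves to the
right, the shifted energy is positive. -/
lemma shiftedEnergy_pos (hz : IsForwardSolution D.field z) {m : ℝ} (hm : D.β ≤ m)
    (h0 : z 0 = (-m, 0)) {t : ℝ} (ht : 0 < t) (hpos : ∀ s ∈ Ioo 0 t, 0 < (z s).2)
    (h : 0 < (z t).2 ∨ -D.β < (z t).1) : 0 < D.shiftedEnergy (z t) := by
  have hβ := D.β_pos
  rcases lt_or_ge D.β |(z t).1| with hx | hx
  · have := D.level_pos hx
    unfold shiftedEnergy; positivity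
  obtain ⟨hx1, hx2⟩ := abs_le.mp hx
  -- Inside the strip, look back to the crossing of `x = -β`: there `W = v² ≥ 0`, and since then the
  -- negative damping has strictly increased `W`.
  have hmono := strictMonoOn_fst hz le_rfl hpos
  obtain ⟨s, hs, hsx⟩ := intermediate_value_Icc ht.le
    ((continuousOn_fst hz).mono (Icc_subset_Ici_zero le_rfl))
    (show -D.β ∈ Icc (z 0).1 (z t).1 by rw [h0]; exact ⟨by simpa using hm, hx1⟩)
  simp only at hsx
  have hs0 : 0 ≤ D.shiftedEnergy (z s) := by
    rw [shiftedEnergy, hsx, level_neg_arg, level_β]; positivity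
  rcases hs.2.eq_or_lt with rfl | hst
  · rcases h with h | h
    · rw [shiftedEnergy, hsx, level_neg_arg, level_β]; positivity
    · exact absurd hsx h.ne'
  refine hs0.trans_lt ?_
  refine strictMonoOn_of_deriv_pos (convex_Icc s t)
    ((continuousOn_shiftedEnergy hz).mono (Icc_subset_Ici_zero hs.1)) (fun u hu => ?_)
    (left_mem_Icc.mpr hst.le) (right_mem_Icc.mpr hst.le) hst
  rw [interior_Icc] at hu
  have hu0 : 0 < u := hs.1.trans_lt hu.1
  rw [(hasDerivAt_shiftedEnergy hz hu0).deriv]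
  have h1 := hmono hs ⟨hu0.le, hu.2.le⟩ hu.1
  have h2 := hmono ⟨hu0.le, hu.2.le⟩ (right_mem_Icc.mpr ht.le) hu.2
  simp only [hsx] at h1 h2
  have h3 := D.f_neg (z u).1 (abs_lt.mpr ⟨h1, by linarith⟩)
  have h4 := hpos u ⟨hu0, hu.2⟩
  have : 0 < -D.f (z u).1 * (z u).2 ^ 2 := mul_pos (by linarith) (by positivity)
  linarith

lemma F_mono {a b : ℝ} (hab : a ≤ b) (h : ∀ x ∈ Ioo a b, D.β ≤ |x|) : D.F a ≤ D.F b := by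
  have := mul_sub_le_of_le_hasDerivAt (c := 0) hab
    (fun x _ => (D.hasDerivAt_F x).continuousAt.continuousWithinAt)
    (fun x _ => D.hasDerivAt_F x) fun x hx => D.f_nonneg (h x hx)
  linarith

/-- An orbit does not stay in the half plane `x < -β`. -/
lemma exists_neg_β_le (hz : IsForwardSolution D.field z) :
    ∃ t, 0 < t ∧ -D.β ≤ (z t).1 := by
  by_contra! hx
  have hβ := D.β_pos
  have hk := D.k_pos
  -- In `x < -β` the Liénard variable grows at rate at least `k β` while `F x ≤ F (-β)`, so `v`
  -- exceeds `1` from time `t₁` on and `x` must escape by time `t₂`.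
  set c := (z 1).2 + D.F (z 1).1 - D.F (-D.β)
  have hv : ∀ t, 1 ≤ t → D.k * D.β * (t - 1) + c ≤ (z t).2 := by
    intro t ht
    have h1 := mul_sub_le_of_le_hasDerivAt (c := D.k * D.β) ht
      ((continuousOn_lienardVariable hz).mono (Icc_subset_Ici_zero zero_le_one))
      (fun s hs => hasDerivAt_lienardVariable hz (by linarith [hs.1]))
      (fun s hs => by nlinarith [hx s (by linarith [hs.1])])
    have h2 : D.F (z t).1 ≤ D.F (-D.β) := F_mono (hx t (by linarith)).le fun x hx' => by
      rw [abs_of_neg (by linarith [hx'.2])]; linarith [hx'.2]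
    simp only [c]
    linarith
  set t₁ := 1 + (1 + |c|) / (D.k * D.β)
  have ht₁ : 1 ≤ t₁ := by
    have : 0 ≤ (1 + |c|) / (D.k * D.β) := by positivity
    linarith
  have hv1 : ∀ t, t₁ ≤ t → 1 ≤ (z t).2 := by
    intro t ht
    refine le_trans ?_ (hv t (ht₁.trans ht))
    have h1 : D.k * D.β * ((1 + |c|) / (D.k * D.β)) ≤ D.k * D.β * (t - 1) := by
      gcongr; simp only [t₁] at ht; linarith
    rw [mul_div_cancel₀ _ (by positivity)] at h1
    linarith [neg_abs_le c]
  set t₂ := t₁ + |(z t₁).1|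
  have ht₂ : t₁ ≤ t₂ := by simp [t₂]
  have h3 := mul_sub_le_of_le_hasDerivAt (c := 1) ht₂
      ((continuousOn_fst hz).mono (Icc_subset_Ici_zero (by linarith)))
      (fun s hs => hasDerivAt_fst hz (by linarith [hs.1]))
      (fun s hs => hv1 s hs.1.le)
  have h4 := hx t₂ (by linarith)
  simp only [t₂] at h3 h4
  linarith [neg_abs_le (z t₁).1]

/-- An orbit in the upper half plane with positive shifted energy passes the line `x = β`. -/
lemma exists_β_le (hz : IsForwardSolution D.field z) {a : ℝ} (ha : 0 < a)
    (hpos : ∀ t, 0 < t → 0 < (z t).2) (hxa : -D.β ≤ (z a).1)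
    (hWa : 0 < D.shiftedEnergy (z a)) : ∃ t, 0 < t ∧ D.β ≤ (z t).1 := by
  by_contra! hx
  have hx' : ∀ t, a ≤ t → -D.β ≤ (z t).1 := fun t ht =>
    hxa.trans ((strictMonoOn_fst hz (a := a) (b := t) ha.le fun s hs =>
      hpos s (ha.trans hs.1)).monotoneOn (left_mem_Icc.mpr ht) (right_mem_Icc.mpr ht) ht)
  have hW : ∀ t, a ≤ t → D.shiftedEnergy (z a) ≤ D.shiftedEnergy (z t) := by
    intro t ht
    have := mul_sub_le_of_le_hasDerivAt (c := 0) ht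
      ((continuousOn_shiftedEnergy hz).mono (Icc_subset_Ici_zero ha.le))
      (fun s hs => hasDerivAt_shiftedEnergy hz (ha.trans hs.1)) (fun s hs => by
        have h1 := D.f_nonpos (abs_le.mpr ⟨hx' s hs.1.le, (hx s (ha.trans hs.1)).le⟩)
        have h2 := mul_nonneg (neg_nonneg.mpr h1) (sq_nonneg (z s).2)
        linarith)
    linarith
  have hv : ∀ t, a ≤ t → √(D.shiftedEnergy (z a)) ≤ (z t).2 := by
    intro t ht
    have h1 := D.level_nonpos (abs_le.mpr ⟨hx' t ht, (hx t (ha.trans_le ht)).le⟩)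
    refine (Real.sqrt_le_left (hpos t (ha.trans_le ht)).le).mpr ?_
    have := hW t ht
    rw [shiftedEnergy.eq_1 D (z t)] at this
    linarith
  have hw : 0 < √(D.shiftedEnergy (z a)) := Real.sqrt_pos.mpr hWa
  have hβ := D.β_pos
  -- Time enough to cross the strip of width `2 β` at a speed of at least `√W`, since inside it `W`
  -- does not decrease and `W ≤ v²`.
  set t₁ := a + 2 * D.β / √(D.shiftedEnergy (z a))
  have ht₁ : a ≤ t₁ := by
    have : 0 ≤ 2 * D.β / √(D.shiftedEnergy (z a)) := by positivity
    linarith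
  have h3 := mul_sub_le_of_le_hasDerivAt ht₁
      ((continuousOn_fst hz).mono (Icc_subset_Ici_zero ha.le))
      (fun s hs => hasDerivAt_fst hz (ha.trans hs.1))
      (fun s hs => hv s hs.1.le)
  have h4 : √(D.shiftedEnergy (z a)) * (t₁ - a) = 2 * D.β := by
    simp only [t₁]; field_simp; ring
  have h5 := hx t₁ (ha.trans_le ht₁)
  linarith

/-- If `v` stayed positive, `x` would pass `-β` and then `β`. Beyond `β` the Liénard variable falls
at rate at least `k β` while `F x ≥ F β`, which forces `v` down to zero. -/
lemma exists_snd_nonpos (hz : IsForwardSolution D.field z) {m : ℝ} (hm : D.β ≤ m)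
    (h0 : z 0 = (-m, 0)) : ∃ t, 0 < t ∧ (z t).2 ≤ 0 := by
  by_contra! hpos
  have hβ := D.β_pos
  have hk := D.k_pos
  obtain ⟨a, ha, hxa⟩ := exists_neg_β_le hz
  obtain ⟨b, hb, hxb⟩ := exists_β_le hz ha hpos hxa
    (shiftedEnergy_pos hz hm h0 ha (fun s hs => hpos s hs.1) (Or.inl (hpos a ha)))
  have hx : ∀ t, b ≤ t → D.β ≤ (z t).1 := fun t ht =>
    hxb.trans ((strictMonoOn_fst hz (a := b) (b := t) hb.le fun s hs =>
      hpos s (hb.trans hs.1)).monotoneOn (left_mem_Icc.mpr ht) (right_mem_Icc.mpr ht) ht)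
  set c := (z b).2 + D.F (z b).1 - D.F D.β
  set t := b + |c| / (D.k * D.β)
  have hbt : b ≤ t := by
    have : 0 ≤ |c| / (D.k * D.β) := by positivity
    linarith
  have h1 := sub_le_mul_of_hasDerivAt_le (c := -(D.k * D.β)) hbt
      ((continuousOn_lienardVariable hz).mono (Icc_subset_Ici_zero hb.le))
      (fun s hs => hasDerivAt_lienardVariable hz (hb.trans hs.1))
      (fun s hs => by nlinarith [hx s hs.1.le])
  have h2 : D.F D.β ≤ D.F (z t).1 := F_mono (hx t hbt) fun x hx' => by
    rw [abs_of_pos (by linarith [hx'.1])]; exact hx'.1.le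
  have h3 : D.k * D.β * (t - b) = |c| := by simp only [t]; field_simp; ring
  have h4 := hpos t (hb.trans_le hbt)
  have h5 := le_abs_self c
  simp only [c] at h3 h5
  linarith

/-- The solution `z` runs through the upper half plane from `(-m, 0)` to `(m', 0)` in time `τ`. -/
structure IsHalfTurn (D : LienardSystem) (z : ℝ → ℝ × ℝ) (m m' τ : ℝ) : Prop where
  isForwardSolution : IsForwardSolution D.field z
  β_le : D.β ≤ m
  β_lt : D.β < m'
  τ_pos : 0 < τ
  start : z 0 = (-m, 0)
  finish : z τ = (m', 0)
  snd_pos : ∀ t ∈ Ioo 0 τ, 0 < (z t).2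

lemma exists_isHalfTurn (hz : IsForwardSolution D.field z) {m : ℝ} (hm : D.β ≤ m)
    (h0 : z 0 = (-m, 0)) : ∃ m' τ, D.IsHalfTurn z m m' τ := by
  have hβ := D.β_pos
  have hk := D.k_pos
  have hd0 : HasDerivWithinAt (fun t => (z t).2) (D.k * m) (Ici 0) 0 := by
    have := hasFDerivAt_snd.comp_hasDerivWithinAt 0 (hz 0 self_mem_Ici)
    simpa [field, h0] using! this
  have hev := hd0.eventually_div_pos (by nlinarith) (by simp [h0])
  rw [Ici_sdiff_left] at hev
  obtain ⟨η, hη, hη'⟩ := mem_nhdsGT_iff_exists_Ioo_subset.mp hev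
  have hη0 : 0 < η := hη
  have hpos : ∀ t ∈ Ioo 0 η, 0 < (z t).2 := fun t ht => by
    have : 0 < (z t).2 / (t - 0) := hη' ht
    rw [sub_zero] at this
    exact (div_pos_iff_of_pos_right ht.1).mp this
  obtain ⟨b, hb, hvb⟩ := exists_snd_nonpos hz hm h0
  have hηb : η ≤ b := by
    by_contra! h
    exact absurd (hpos b ⟨hb, h⟩) (not_lt.mpr hvb)
  have hcont := continuousOn_snd hz
  -- The search for the first return starts at `η / 2` because `v` also vanishes at time `0`.
  have hclosed : IsCompact (Icc (η / 2) b ∩ (fun t => (z t).2) ⁻¹' Iic 0) :=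
    isCompact_Icc.of_isClosed_subset ((hcont.mono (Icc_subset_Ici_zero (by linarith)))
      |>.preimage_isClosed_of_isClosed isClosed_Icc isClosed_Iic) inter_subset_left
  obtain ⟨τ, ⟨hτ, hvτ⟩, hmin⟩ := hclosed.exists_isLeast ⟨b, ⟨by linarith, le_rfl⟩, hvb⟩
  have hτ0 : 0 < τ := by linarith [hτ.1]
  have hposτ : ∀ t ∈ Ioo 0 τ, 0 < (z t).2 := by
    intro t ht
    rcases lt_or_ge t η with h | h
    · exact hpos t ⟨ht.1, h⟩
    · by_contra! h'
      exact absurd (hmin ⟨⟨by linarith, ht.2.le.trans hτ.2⟩, h'⟩) (not_le.mpr ht.2)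
  have hvτ0 : (z τ).2 = 0 := by
    refine le_antisymm hvτ ?_
    by_contra! hneg
    obtain ⟨c, hc, hc0⟩ := intermediate_value_Icc' (a := τ / 2) (b := τ) (by linarith)
      (hcont.mono (Icc_subset_Ici_zero (by linarith)))
      ⟨hneg.le, (hposτ (τ / 2) ⟨by linarith, by linarith⟩).le⟩
    rcases hc.2.eq_or_lt with rfl | hlt
    · exact hneg.ne hc0
    · exact (hposτ c ⟨by linarith [hc.1], hlt⟩).ne' hc0
  -- If `x ≤ -β` at the return, then `v' = -k x > 0` there, so `v` would be negative just before.
  -- Once `-β` is passed, `W > 0` with `v = 0` pushes `x` beyond `β`.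
  have hxτ : -D.β < (z τ).1 := by
    by_contra! hle
    have hdτ := (hasDerivAt_snd hz hτ0).hasDerivWithinAt (s := Iic τ)
    rw [hvτ0] at hdτ
    have hev := hdτ.eventually_div_pos (by nlinarith) hvτ0
    rw [Iic_sdiff_right] at hev
    obtain ⟨t, ht, ht'⟩ := (hev.and (Ioo_mem_nhdsLT hτ0)).exists
    have := hposτ t ht'
    exact absurd ht (not_lt.mpr (div_nonpos_of_nonneg_of_nonpos this.le (by linarith [ht'.2])))
  have hW := shiftedEnergy_pos hz hm h0 hτ0 hposτ (Or.inr hxτ)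
  rw [shiftedEnergy, hvτ0, zero_pow two_ne_zero, zero_add] at hW
  have hxβ : D.β < (z τ).1 := by
    by_contra! hle
    exact absurd hW (not_lt.mpr (D.level_nonpos (abs_le.mpr ⟨hxτ.le, hle⟩)))
  exact ⟨(z τ).1, τ, hz, hm, hxβ, hτ0, h0, Prod.ext rfl hvτ0, hposτ⟩

/-- While `v > 0`, `x` is strictly increasing, so time is a function `s` of `x`. It is continuous
because a continuous injection of a compact interval is an embedding, and differentiable with
derivative `1 / v` inside. -/
lemma IsHalfTurn.exists_isArc {m m' τ : ℝ} (h : D.IsHalfTurn z m m' τ) :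
    ∃ y, D.IsArc m m' y := by
  have hz := h.isForwardSolution
  have hτ := h.τ_pos
  have hmono := strictMonoOn_fst hz le_rfl h.snd_pos
  have hmm : -m ≤ m' := by linarith [h.β_le, h.β_lt, D.β_pos]
  have hcx : ContinuousOn (fun t => (z t).1) (Icc 0 τ) :=
    (continuousOn_fst hz).mono (Icc_subset_Ici_zero le_rfl)
  have hsurj : ∀ ξ : Icc (-m) m', ∃ t : Icc 0 τ, (z t).1 = ξ := by
    intro ξ
    have := intermediate_value_Icc hτ.le hcx
    simp only [h.start, h.finish] at this
    obtain ⟨t, ht, hξ⟩ := this ξ.2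
    exact ⟨⟨t, ht⟩, hξ⟩
  choose σ hσ using hsurj
  have hemb : IsClosedEmbedding (fun t : Icc 0 τ => (z t).1) :=
    (continuousOn_iff_continuous_domRestrict.mp hcx).isClosedEmbedding
      (injOn_iff_injective.mp hmono.injOn)
  have hσc : Continuous σ := by
    rw [hemb.isInducing.continuous_iff]
    have : (fun t : Icc 0 τ => (z t).1) ∘ σ = Subtype.val := funext hσ
    rw [this]; exact continuous_subtype_val
  set s : ℝ → ℝ := IccExtend hmm (fun ξ => (σ ξ : ℝ)) with hs
  have hsc : Continuous s := (continuous_subtype_val.comp hσc).Icc_extend'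
  have hsmem : ∀ ξ, s ξ ∈ Icc 0 τ := fun ξ => (σ _).2
  have hsx : ∀ ξ ∈ Icc (-m) m', (z (s ξ)).1 = ξ := by
    intro ξ hξ
    rw [hs, IccExtend_of_mem hmm _ hξ]
    exact hσ ⟨ξ, hξ⟩
  have hs_mem : ∀ ξ ∈ Ioo (-m) m', s ξ ∈ Ioo 0 τ := by
    intro ξ hξ
    have h1 := hsx ξ (Ioo_subset_Icc_self hξ)
    refine ⟨(hsmem ξ).1.lt_of_ne fun h0 => ?_, (hsmem ξ).2.lt_of_ne fun h0 => ?_⟩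
    · rw [← h0, h.start] at h1
      exact hξ.1.ne h1
    · rw [h0, h.finish] at h1
      exact hξ.2.ne h1.symm
  have hs0 : s (-m) = 0 := by
    refine hmono.injOn (hsmem _) (left_mem_Icc.mpr hτ.le) ?_
    simp only [hsx (-m) (left_mem_Icc.mpr hmm), h.start]
  have hsτ : s m' = τ := by
    refine hmono.injOn (hsmem _) (right_mem_Icc.mpr hτ.le) ?_
    simp only [hsx m' (right_mem_Icc.mpr hmm), h.finish]
  refine ⟨fun ξ => (z (s ξ)).2, h.β_le, h.β_lt, ?_, ?_, ?_, ?_, ?_, ?_⟩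
  · exact (continuousOn_snd hz).comp hsc.continuousOn fun ξ _ => (hsmem ξ).1
  · simp [hs0, h.start]
  · simp [hsτ, h.finish]
  · exact fun ξ hξ => h.snd_pos _ (hs_mem ξ hξ)
  · intro ξ hξ
    have h1 := hs_mem ξ hξ
    have h2 := (h.snd_pos _ h1).ne'
    have h3 : HasDerivAt s ((z (s ξ)).2)⁻¹ ξ :=
      HasDerivAt.of_local_left_inverse hsc.continuousAt (hasDerivAt_fst hz h1.1) h2
        (eventually_of_mem (Ioo_mem_nhds hξ.1 hξ.2) fun ξ' hξ' => hsx ξ' (Ioo_subset_Icc_self hξ'))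
    have h4 := (hasDerivAt_snd hz h1.1).comp ξ h3
    refine h4.congr_deriv ?_
    rw [hsx ξ (Ioo_subset_Icc_self hξ)]
    field_simp
  · intro ξ hξ
    have h1 := hs_mem ξ hξ
    have := shiftedEnergy_pos hz h.β_le h.start h1.1
      (fun u hu => h.snd_pos u ⟨hu.1, hu.2.trans h1.2⟩) (Or.inl (h.snd_pos _ h1))
    rwa [shiftedEnergy, hsx ξ (Ioo_subset_Icc_self hξ)] at this

/-- There is an orbit that runs from `(-m, 0)` to `(m, 0)` through the upper half plane. -/
lemma exists_isHalfTurn_self (D : LienardSystem) :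
    ∃ z m τ, D.β < m ∧ D.IsHalfTurn z m m τ := by
  have hex : ∀ m, D.β ≤ m → ∃ z m' τ, D.IsHalfTurn z m m' τ := fun m hm => by
    obtain ⟨z, hz, h0⟩ := D.exists_isForwardSolution (-m, 0)
    exact ⟨z, exists_isHalfTurn hz hm h0⟩
  obtain ⟨m, y, hy⟩ := exists_isArc_self (D := D) fun m hm => by
    obtain ⟨z, m', τ, h⟩ := hex m hm
    exact ⟨m', h.exists_isArc⟩
  obtain ⟨z, m', τ, h⟩ := hex m hy.β_le
  obtain ⟨y', hy'⟩ := h.exists_isArc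
  have : m' = m := height_injOn hy'.β_lt.le hy.β_lt.le (hy'.height_eq_height hy)
  exact ⟨z, m, τ, hy.β_lt, by rwa [this] at h⟩

end LienardSystem

/-! ### The symmetric cycle. -/

/-- A forward solution that is periodic on `[0, ∞)` extends to a periodic solution on the line. -/
lemma PlanarFlow.IsForwardSolution.exists_periodic_extension {V : Type*} [NormedAddCommGroup V]
    [NormedSpace ℝ V] {X : V → V} {z : ℝ → V} (hz : IsForwardSolution X z) {T : ℝ} (hT : 0 < T)
    (hper : ∀ t, 0 ≤ t → z (t + T) = z t) :
    ∃ w : ℝ → V, IsIntegralCurve w (fun _ => X) ∧ Function.Periodic w T ∧ EqOn w z (Ici 0) := by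
  have hn : ∀ (n : ℕ) (t : ℝ), 0 ≤ t → z (t + n * T) = z t := by
    intro n t ht
    induction n with
    | zero => simp
    | succ n ih =>
      rw [← ih, ← hper (t + n * T) (by positivity)]
      congr 1; push_cast; ring
  set w : ℝ → V := fun t => z (toIcoMod hT 0 t) with hw
  have hwper : Function.Periodic w T := fun t => by simp only [hw, toIcoMod_add_right]
  have hwz : EqOn w z (Ici 0) := by
    intro t (ht : 0 ≤ t)
    have h1 := toIcoMod_add_toIcoDiv_zsmul hT 0 t
    have h2 := toIcoMod_mem_Ico hT 0 t
    have h3 : 0 ≤ toIcoDiv hT 0 t := by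
      by_contra! h
      have : (toIcoDiv hT 0 t : ℝ) ≤ -1 := by exact_mod_cast Int.le_sub_one_of_lt h
      rw [zsmul_eq_mul] at h1
      have := h2.2
      nlinarith
    obtain ⟨n, hn'⟩ := Int.eq_ofNat_of_zero_le h3
    have h4 := hn n _ h2.1
    rw [hn', zsmul_eq_mul, Int.cast_natCast] at h1
    exact h4.symm.trans (congrArg z h1)
  refine ⟨w, fun t => ?_, hwper, hwz⟩
  -- Move by whole periods to a positive time, where the derivative is two-sided and `w` agrees with
  -- `z`.
  obtain ⟨n, hn'⟩ := exists_nat_gt (-t / T)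
  have hpos : 0 < t + n * T := by
    rw [div_lt_iff₀ hT] at hn'; linarith
  have hwn : ∀ s, w (s + n * T) = w s := fun s => hwper.nat_mul n s
  have h1 : HasDerivAt (fun s : ℝ => s + n * T) 1 t := (hasDerivAt_id t).add_const _
  have h2 := (hz.hasDerivAt hpos).scomp t h1
  rw [one_smul, ← hwz hpos.le, hwn] at h2
  refine h2.congr_of_eventuallyEq ?_
  have : ∀ᶠ s in 𝓝 t, 0 < s + n * T := h1.continuousAt.eventually (lt_mem_nhds hpos)
  filter_upwards [this] with s hs
  rw [Function.comp_apply, ← hwz hs.le, hwn]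

namespace LienardSystem

variable {D : LienardSystem} {z : ℝ → ℝ × ℝ}

namespace IsHalfTurn

variable {m m' τ : ℝ}

/-- The reflected continuation of a solution after a half turn. -/
lemma isForwardSolution_neg_shift (h : D.IsHalfTurn z m m' τ) :
    IsForwardSolution D.field (fun t => -z (t + τ)) :=
  neg_isForwardSolution (h.isForwardSolution.shift h.τ_pos.le)

lemma neg_shift_zero (h : D.IsHalfTurn z m m' τ) : -z (0 + τ) = (-m', 0) := by
  rw [zero_add, h.finish]; simp

/-- The field is odd, so the reflected continuation is a solution; with `m' = m` it starts at the
same point as `z`, and forward uniqueness applies. -/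
lemma add_eq_neg (h : D.IsHalfTurn z m m τ) {t : ℝ} (ht : 0 ≤ t) : z (t + τ) = -z t := by
  rw [← neg_eq_iff_eq_neg]
  exact D.eq_of_isForwardSolution h.isForwardSolution_neg_shift h.isForwardSolution
    (h.neg_shift_zero.trans h.start.symm) ht

end IsHalfTurn

/-- A closed orbit consisting of two symmetric half turns. -/
structure IsSymmetricCycle (D : LienardSystem) (w : ℝ → ℝ × ℝ) (m τ : ℝ) : Prop where
  isIntegralCurve : IsIntegralCurve w (fun _ => D.field)
  isHalfTurn : D.IsHalfTurn w m m τ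
  add_τ : ∀ t, w (t + τ) = -w t

lemma exists_isSymmetricCycle (D : LienardSystem) : ∃ w m τ, D.IsSymmetricCycle w m τ := by
  obtain ⟨z, m, τ, hm, h⟩ := D.exists_isHalfTurn_self
  have hτ := h.τ_pos
  obtain ⟨w, hw, hper, hwz⟩ := h.isForwardSolution.exists_periodic_extension (T := 2 * τ)
    (by positivity) fun t ht => by
      rw [two_mul, ← add_assoc, h.add_eq_neg (by positivity), h.add_eq_neg ht, neg_neg]
  have hw' : D.IsHalfTurn w m m τ :=
    { isForwardSolution := hw.isIntegralCurveOn _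
      β_le := hm.le
      β_lt := hm
      τ_pos := hτ
      start := by rw [hwz self_mem_Ici, h.start]
      finish := by rw [hwz hτ.le, h.finish]
      snd_pos := fun t ht => by rw [hwz ht.1.le]; exact h.snd_pos t ht }
  refine ⟨w, m, τ, hw, hw', fun t => ?_⟩
  obtain ⟨n, hn⟩ := exists_nat_gt (-t / (2 * τ))
  rw [div_lt_iff₀ (by positivity)] at hn
  rw [← hper.nat_mul n t, ← hper.nat_mul n (t + τ), ← hw'.add_eq_neg (by linarith)]
  congr 1; ring

namespace IsSymmetricCycle

variable {w : ℝ → ℝ × ℝ} {m τ : ℝ}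

lemma periodic (hw : D.IsSymmetricCycle w m τ) : Function.Periodic w (2 * τ) := fun t => by
  rw [two_mul, ← add_assoc, hw.add_τ, hw.add_τ, neg_neg]

lemma isClosedOrbit (hw : D.IsSymmetricCycle w m τ) : IsClosedOrbit D.field (range w) := by
  have h := hw.isHalfTurn
  refine ⟨w, hw.isIntegralCurve, ⟨2 * τ, by linarith [h.τ_pos], hw.periodic⟩, ⟨τ, ?_⟩, rfl⟩
  rw [h.start, h.finish]
  intro he
  have := congrArg Prod.fst he
  simp only at this
  linarith [h.β_lt, D.β_pos]

lemma isCompact_range (hw : D.IsSymmetricCycle w m τ) : IsCompact (range w) := by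
  rw [← hw.periodic.image_Icc (by linarith [hw.isHalfTurn.τ_pos]) 0]
  exact isCompact_Icc.image hw.isIntegralCurve.continuous

lemma infDist_neg (hw : D.IsSymmetricCycle w m τ) (p : ℝ × ℝ) :
    Metric.infDist (-p) (range w) = Metric.infDist p (range w) := by
  have hneg : ∀ q ∈ range w, -q ∈ range w := by
    rintro _ ⟨t, rfl⟩
    exact ⟨t + τ, hw.add_τ t⟩
  have hle : ∀ p : ℝ × ℝ, Metric.infDist (-p) (range w) ≤ Metric.infDist p (range w) := by
    intro p
    obtain ⟨q, hq, hpq⟩ := hw.isCompact_range.exists_infDist_eq_dist (range_nonempty w) p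
    rw [hpq, ← dist_neg_neg]
    exact Metric.infDist_le_dist_of_mem (hneg q hq)
  exact (hle p).antisymm (by simpa using hle (-p))

/-! ### Stability and attraction. -/

/-- Half turns that start near a symmetric cycle stay near it and take a time bounded below. -/
lemma exists_forall_isHalfTurn (hw : D.IsSymmetricCycle w m τ) : ∃ c, 0 < c ∧ ∀ ε, 0 < ε →
    ∃ δ, 0 < δ ∧ ∀ z m₁ m₁' τ₁, D.IsHalfTurn z m₁ m₁' τ₁ → |m₁ - m| < δ →
      c ≤ τ₁ ∧ ∀ t ∈ Icc 0 τ₁, Metric.infDist (z t) (range w) < ε := by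
  have h := hw.isHalfTurn
  have hτ := h.τ_pos
  have hβ := D.β_pos
  have hm : 0 < m := hβ.trans h.β_lt
  obtain ⟨R', hR', hb⟩ := D.exists_norm_le (m + 1) (τ + τ / 2)
  obtain ⟨L, hL, hdist⟩ := D.exists_dist_le (m + 1) (τ + τ / 2)
  -- A half turn covers the horizontal distance `m₁ + m₁' ≥ 2 β` at speed at most `R'`.
  refine ⟨2 * D.β / R', by positivity, fun ε hε => ?_⟩
  have hv := h.snd_pos (τ / 2) ⟨by linarith, by linarith⟩
  -- The last bound forces the half turn to end by time `3τ/2`: there the cycle has `v = -(w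
  -- (τ/2)).2 < 0`, and `z` is too close to it to have `v > 0`.
  refine ⟨min 1 (min (ε / L) ((w (τ / 2)).2 / L)), by positivity, ?_⟩
  intro z m₁ m₁' τ₁ h₁ hm₁
  rw [lt_min_iff, lt_min_iff, lt_div_iff₀' hL, lt_div_iff₀' hL] at hm₁
  obtain ⟨hm1, hm2, hm3⟩ := hm₁
  have hnw : ‖w 0‖ ≤ m + 1 := by
    rw [h.start]; simp [Prod.norm_def, abs_of_pos hm]; linarith
  have hnz : ‖z 0‖ ≤ m + 1 := by
    rw [h₁.start]
    have := abs_lt.mp hm1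
    simp [Prod.norm_def, abs_of_pos (hβ.trans_le h₁.β_le)]; exact ⟨by linarith, by linarith⟩
  have hd0 : dist (z 0) (w 0) = |m₁ - m| := by
    rw [h₁.start, h.start, Prod.dist_eq, dist_self, Real.dist_eq, max_eq_left (abs_nonneg _),
      ← abs_neg]
    ring_nf
  have hzi : ∀ T, IsIntegralCurveOn z (fun _ => D.field) (Icc 0 T) := fun T =>
    IsIntegralCurveOn.mono h₁.isForwardSolution Icc_subset_Ici_self
  have hclose : ∀ t ∈ Icc 0 (τ + τ / 2), dist (z t) (w t) ≤ L * |m₁ - m| := fun t ht => by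
    rw [← hd0]
    exact hdist _ z w le_rfl (hzi _) (hw.isIntegralCurve.isIntegralCurveOn _) hnz hnw t ht
  have hτ₁ : τ₁ ≤ τ + τ / 2 := by
    by_contra! hlt
    have h2 := h₁.snd_pos (τ + τ / 2) ⟨by linarith, hlt⟩
    have h3 := hclose (τ + τ / 2) ⟨by linarith, le_rfl⟩
    rw [add_comm τ, hw.add_τ] at h3
    rw [add_comm] at h2
    have h4 := (le_max_right _ _).trans ((Prod.dist_eq (x := z (τ / 2 + τ)) (y := _)).symm.le.trans h3)
    rw [Real.dist_eq, Prod.snd_neg] at h4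
    linarith [le_abs_self ((z (τ / 2 + τ)).2 - -(w (τ / 2)).2)]
  refine ⟨?_, fun t ht => ?_⟩
  · have hspeed := sub_le_mul_of_hasDerivAt_le (c := R') h₁.τ_pos.le
      ((continuousOn_fst h₁.isForwardSolution).mono (Icc_subset_Ici_zero le_rfl))
      (fun t ht => hasDerivAt_fst h₁.isForwardSolution ht.1) (fun t ht => by
        refine (le_abs_self _).trans ((norm_snd_le (z t)).trans ?_)
        exact hb (fun _ => 1) τ₁ z (by simp) (by simp) hτ₁ (by simpa using hzi τ₁) hnz t
          ⟨ht.1.le, ht.2.le⟩)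
    rw [h₁.start, h₁.finish] at hspeed
    rw [div_le_iff₀ hR']
    have := h₁.β_le
    have := h₁.β_lt
    simp only at hspeed
    linarith
  · exact (Metric.infDist_le_dist_of_mem (mem_range_self t)).trans_lt
      ((hclose t ⟨ht.1, ht.2.trans hτ₁⟩).trans_lt hm2)

lemma abs_height_sub_le (hw : D.IsSymmetricCycle w m τ) {m₁ m₁' τ₁ : ℝ}
    (h₁ : D.IsHalfTurn z m₁ m₁' τ₁) :
    |D.height m₁' - D.height m| ≤ |D.height m₁ - D.height m| := by
  obtain ⟨y, hy⟩ := hw.isHalfTurn.exists_isArc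
  obtain ⟨y₁, hy₁⟩ := h₁.exists_isArc
  rcases eq_or_ne m m₁ with rfl | hne
  · rw [hy.height_eq_height hy₁]
  · exact (hy.abs_height_sub_height_lt hy₁ hne).le

end IsSymmetricCycle

lemma continuous_height (D : LienardSystem) : Continuous D.height := D.continuous_level.sqrt

/-- The height is strictly increasing on `[β, ∞)`, so its inverse is continuous at the height of
`m`. -/
lemma exists_abs_sub_lt_of_abs_height_sub_lt {m : ℝ} (hm : D.β < m) {δ : ℝ} (hδ : 0 < δ) :
    ∃ ρ, 0 < ρ ∧ ∀ m₁, D.β ≤ m₁ → |D.height m₁ - D.height m| < ρ → |m₁ - m| < δ := by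
  have ha : max D.β (m - δ) < m := max_lt hm (by linarith)
  have h1 := height_lt_height (D := D) (le_max_left _ _) ha
  have h2 := height_lt_height (D := D) hm.le (show m < m + δ by linarith)
  refine ⟨min (D.height m - D.height (max D.β (m - δ))) (D.height (m + δ) - D.height m),
    lt_min (by linarith) (by linarith), fun m₁ hm₁ hlt => ?_⟩
  obtain ⟨h3, h4⟩ := lt_min_iff.mp hlt
  rw [abs_lt] at h3 h4 ⊢
  constructor
  · by_contra! hle
    have := IsArc.height_mono (D := D) hm₁ (show m₁ ≤ max D.β (m - δ) from
      (by linarith : m₁ ≤ m - δ).trans (le_max_right _ _))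
    linarith
  · by_contra! hle
    have := IsArc.height_mono (D := D) (x := m + δ) (y := m₁) (by linarith) (by linarith)
    linarith

namespace IsSymmetricCycle

variable {w : ℝ → ℝ × ℝ} {m τ : ℝ}

/-- Solutions that start on the negative `x`-axis near a symmetric cycle stay near it. -/
lemma exists_forall_infDist_lt (hw : D.IsSymmetricCycle w m τ) {ε : ℝ} (hε : 0 < ε) :
    ∃ ρ, 0 < ρ ∧ ∀ z m₁, IsForwardSolution D.field z → z 0 = (-m₁, 0) → D.β ≤ m₁ →
      |m₁ - m| < ρ → ∀ t, 0 ≤ t → Metric.infDist (z t) (range w) < ε := by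
  obtain ⟨c, hc, hturn⟩ := hw.exists_forall_isHalfTurn
  obtain ⟨δ, hδ, hturn⟩ := hturn ε hε
  obtain ⟨ρ', hρ', hh⟩ := exists_abs_sub_lt_of_abs_height_sub_lt hw.isHalfTurn.β_lt hδ
  obtain ⟨ρ, hρ, hρh⟩ := Metric.continuous_iff.mp D.continuous_height m ρ' hρ'
  -- Each half turn takes time at least `c` and keeps the height bound; reflecting after it restores
  -- the starting situation, so `n + 1` half turns cover `[0, n c]`.
  have key : ∀ (n : ℕ) (z : ℝ → ℝ × ℝ) (m₁ : ℝ), IsForwardSolution D.field z →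
      z 0 = (-m₁, 0) → D.β ≤ m₁ → |D.height m₁ - D.height m| < ρ' →
      ∀ t ∈ Icc 0 (n * c), Metric.infDist (z t) (range w) < ε := by
    intro n
    induction n with
    | zero =>
      intro z m₁ hz h0 hm₁ hlt t ht
      obtain ⟨m₁', τ₁, h₁⟩ := exists_isHalfTurn hz hm₁ h0
      refine (hturn z m₁ m₁' τ₁ h₁ (hh m₁ hm₁ hlt)).2 t ⟨ht.1, ht.2.trans ?_⟩
      simpa using h₁.τ_pos.le
    | succ n ih =>
      intro z m₁ hz h0 hm₁ hlt t ht
      obtain ⟨m₁', τ₁, h₁⟩ := exists_isHalfTurn hz hm₁ h0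
      obtain ⟨hcτ, hnear⟩ := hturn z m₁ m₁' τ₁ h₁ (hh m₁ hm₁ hlt)
      rcases le_or_gt t τ₁ with hle | hgt
      · exact hnear t ⟨ht.1, hle⟩
      · have ht2 := ht.2
        push_cast at ht2
        have := ih _ m₁' h₁.isForwardSolution_neg_shift h₁.neg_shift_zero h₁.β_lt.le
          ((hw.abs_height_sub_le h₁).trans_lt hlt) (t - τ₁) ⟨by linarith, by linarith⟩
        rwa [hw.infDist_neg, sub_add_cancel] at this
  refine ⟨ρ, hρ, fun z m₁ hz h0 hm₁ hlt t ht => ?_⟩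
  obtain ⟨n, hn⟩ := exists_nat_ge (t / c)
  exact key n z m₁ hz h0 hm₁ (by simpa [Real.dist_eq] using hρh m₁ (by simpa [Real.dist_eq] using hlt))
    t ⟨ht, (div_le_iff₀ hc).mp hn⟩

/-- Away from the cycle, the half return map decreases the height difference by a fixed amount. -/
lemma exists_height_decrease (hw : D.IsSymmetricCycle w m τ) {ε : ℝ} (hε : 0 < ε) (B : ℝ) :
    ∃ κ, 0 < κ ∧ ∀ z m₁ m₁' τ₁, D.IsHalfTurn z m₁ m₁' τ₁ → ε ≤ |D.height m₁ - D.height m| →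
      |D.height m₁ - D.height m| ≤ B →
      |D.height m₁' - D.height m| ≤ |D.height m₁ - D.height m| - κ := by
  have hex : ∀ m₁, D.β ≤ m₁ → ∃ m₁' y, D.IsArc m₁ m₁' y := fun m₁ hm₁ => by
    obtain ⟨z, hz, h0⟩ := D.exists_isForwardSolution (-m₁, 0)
    obtain ⟨m', τ, h⟩ := exists_isHalfTurn hz hm₁ h0
    exact ⟨m', h.exists_isArc⟩
  choose! Q y hQ using hex
  obtain ⟨y₀, hy₀⟩ := hw.isHalfTurn.exists_isArc
  -- Continuity of the return height comes from the contraction itself. The strict decrease then has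
  -- a positive minimum on the compact set `K`.
  have hcont : ContinuousOn (fun m₁ => D.height (Q m₁)) (Ici D.β) := by
    rw [Metric.continuousOn_iff]
    intro b hb e he
    obtain ⟨d, hd, hd'⟩ := Metric.continuous_iff.mp D.continuous_height b e he
    refine ⟨d, hd, fun a ha hab => ?_⟩
    rcases eq_or_ne b a with rfl | hne
    · simpa using he
    · refine lt_trans ?_ (hd' a hab)
      simpa only [Real.dist_eq] using (hQ b hb).abs_height_sub_height_lt (hQ a ha) hne
  obtain ⟨M, hM, hMh⟩ := D.exists_height_eq (w := D.height m + |B|)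
    (add_nonneg (Real.sqrt_nonneg _) (abs_nonneg _))
  set K := Icc D.β M ∩ {m₁ | ε ≤ |D.height m₁ - D.height m|} with hK
  have hKc : IsCompact K := isCompact_Icc.inter_right
    (isClosed_le continuous_const (D.continuous_height.sub continuous_const).abs)
  have hmemK : ∀ m₁, D.β ≤ m₁ → ε ≤ |D.height m₁ - D.height m| →
      |D.height m₁ - D.height m| ≤ B → m₁ ∈ K := by
    refine fun m₁ h1 h2 h3 => ⟨⟨h1, ?_⟩, h2⟩
    by_contra! hlt
    have h4 := height_lt_height hM hlt
    linarith [le_abs_self (D.height m₁ - D.height m), le_abs_self B]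
  have hval : ∀ z m₁ m₁' τ₁, D.IsHalfTurn z m₁ m₁' τ₁ → D.height m₁' = D.height (Q m₁) := by
    intro z m₁ m₁' τ₁ h₁
    obtain ⟨y₁, hy₁⟩ := h₁.exists_isArc
    exact hy₁.height_eq_height (hQ m₁ h₁.β_le)
  rcases K.eq_empty_or_nonempty with hemp | hne
  · refine ⟨1, one_pos, fun z m₁ m₁' τ₁ h₁ h2 h3 => ?_⟩
    exact absurd (hmemK m₁ h₁.β_le h2 h3) (by simp [hemp])
  obtain ⟨a, ha, hmin⟩ := hKc.exists_isMinOn hne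
    (f := fun m₁ => |D.height m₁ - D.height m| - |D.height (Q m₁) - D.height m|)
    ((D.continuous_height.sub continuous_const).abs.continuousOn.sub
      ((hcont.mono fun x hx => hx.1.1).sub continuousOn_const).abs)
  refine ⟨|D.height a - D.height m| - |D.height (Q a) - D.height m|, ?_, ?_⟩
  · have hne : m ≠ a := by
      rintro rfl
      have := ha.2
      simp only [mem_ofPred_eq, sub_self, abs_zero] at this
      linarith
    exact sub_pos.mpr (hy₀.abs_height_sub_height_lt (hQ a ha.1.1) hne)
  · intro z m₁ m₁' τ₁ h₁ h2 h3
    have := hmin (hmemK m₁ h₁.β_le h2 h3)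
    simp only [mem_ofPred_eq] at this
    rw [hval z m₁ m₁' τ₁ h₁]
    linarith

/-- Solutions that start on the `x`-axis outside `(-β, β)` come back to it arbitrarily close to the
symmetric cycle. -/
lemma exists_return_near (hw : D.IsSymmetricCycle w m τ) {ρ : ℝ} (hρ : 0 < ρ) {m₁ : ℝ}
    (hz : IsForwardSolution D.field z) (h0 : z 0 = (-m₁, 0)) (hm₁ : D.β ≤ m₁) :
    ∃ t m₂, 0 ≤ t ∧ D.β ≤ m₂ ∧ |m₂ - m| < ρ ∧ (z t = (-m₂, 0) ∨ -z t = (-m₂, 0)) := by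
  obtain ⟨ε, hε, hh⟩ := exists_abs_sub_lt_of_abs_height_sub_lt hw.isHalfTurn.β_lt hρ
  obtain ⟨κ, hκ, hdec⟩ := hw.exists_height_decrease hε |D.height m₁ - D.height m|
  have key : ∀ (n : ℕ) (z : ℝ → ℝ × ℝ) (a : ℝ), IsForwardSolution D.field z →
      z 0 = (-a, 0) → D.β ≤ a → |D.height a - D.height m| ≤ |D.height m₁ - D.height m| →
      |D.height a - D.height m| < ε + n * κ →
      ∃ t m₂, 0 ≤ t ∧ D.β ≤ m₂ ∧ |m₂ - m| < ρ ∧ (z t = (-m₂, 0) ∨ -z t = (-m₂, 0)) := by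
    intro n
    induction n with
    | zero =>
      intro z a hz h0 ha _ hlt
      exact ⟨0, a, le_rfl, ha, hh a ha (by simpa using hlt), Or.inl h0⟩
    | succ n ih =>
      intro z a hz h0 ha hle hlt
      rcases lt_or_ge |D.height a - D.height m| ε with hlt' | hge
      · exact ⟨0, a, le_rfl, ha, hh a ha hlt', Or.inl h0⟩
      obtain ⟨a', τ₁, h₁⟩ := exists_isHalfTurn hz ha h0
      have h2 := hdec z a a' τ₁ h₁ hge hle
      push_cast at hlt
      obtain ⟨t, m₂, ht, hm₂, hlt₂, hor⟩ := ih _ a' h₁.isForwardSolution_neg_shift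
        h₁.neg_shift_zero h₁.β_lt.le (by linarith) (by linarith)
      refine ⟨t + τ₁, m₂, add_nonneg ht h₁.τ_pos.le, hm₂, hlt₂, ?_⟩
      rw [neg_neg] at hor
      exact hor.symm
  obtain ⟨n, hn⟩ := exists_nat_gt (|D.height m₁ - D.height m| / κ)
  rw [div_lt_iff₀ hκ] at hn
  exact key n z m₁ hz h0 hm₁ le_rfl (by linarith)

/-- The orbit returns to the axis within the stability radius of any given `ε`, possibly on the
positive side, where reflection applies; from then on it stays `ε`-close. -/
lemma tendsto_infDist (hw : D.IsSymmetricCycle w m τ) {m₁ : ℝ}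
    (hz : IsForwardSolution D.field z) (h0 : z 0 = (-m₁, 0)) (hm₁ : D.β ≤ m₁) :
    Tendsto (fun t => Metric.infDist (z t) (range w)) atTop (𝓝 0) := by
  rw [Metric.tendsto_atTop]
  intro ε hε
  obtain ⟨ρ, hρ, hstab⟩ := hw.exists_forall_infDist_lt hε
  obtain ⟨t₀, m₂, ht₀, hm₂, hlt, hor⟩ := hw.exists_return_near hρ hz h0 hm₁
  refine ⟨t₀, fun t ht => ?_⟩
  rw [Real.dist_0_eq_abs, abs_of_nonneg Metric.infDist_nonneg]
  rcases hor with h | h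
  · have := hstab _ m₂ (hz.shift ht₀) (by simpa using h) hm₂ hlt (t - t₀) (by linarith)
    simpa using this
  · have := hstab _ m₂ (neg_isForwardSolution (hz.shift ht₀)) (by simpa using h) hm₂ hlt (t - t₀)
      (by linarith)
    rw [hw.infDist_neg] at this
    simpa using this

end IsSymmetricCycle

end LienardSystem

lemma Filter.Tendsto.of_comp_add_const {α : Type*} {l : Filter α} {g : ℝ → α} (h : ℝ)
    (hg : Tendsto (fun t => g (t + h)) atTop l) : Tendsto g atTop l := by
  have := hg.comp (tendsto_atTop_add_const_right atTop (-h) tendsto_id)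
  refine this.congr fun t => ?_
  simp

namespace LienardSystem

variable {D : LienardSystem} {z : ℝ → ℝ × ℝ}

namespace IsSymmetricCycle

variable {w : ℝ → ℝ × ℝ} {m τ : ℝ}

/-- Solutions that start near a symmetric cycle stay near it until they meet the negative
`x`-axis. -/
lemma exists_hit (hw : D.IsSymmetricCycle w m τ) {ε ρ : ℝ} (hε : 0 < ε) (hρ : 0 < ρ) :
    ∃ δ, 0 < δ ∧ ∀ z, IsForwardSolution D.field z → Metric.infDist (z 0) (range w) < δ →
      ∃ h m₂, 0 ≤ h ∧ D.β ≤ m₂ ∧ |m₂ - m| < ρ ∧ z h = (-m₂, 0) ∧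
        ∀ t ∈ Icc 0 h, Metric.infDist (z t) (range w) < ε := by
  have h := hw.isHalfTurn
  have hτ := h.τ_pos
  have hm := h.β_lt
  have hwc := hw.isIntegralCurve.continuous
  obtain ⟨R, hR⟩ := hw.isCompact_range.isBounded.exists_norm_le
  -- The nearest cycle point is `w s` with `0 ≤ s ≤ 2τ`, so at time `4τ - s ∈ [2τ, 4τ]` the
  -- companion solution is at `(-m, 0)`. A window of half-width `η < τ` about it lies in `[0, 5τ]`,
  -- and `v` changes sign there.
  obtain ⟨L, hL, hdist⟩ := D.exists_dist_le (R + 1) (5 * τ)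
  set r := min ρ (m - D.β) / 2 with hr
  have hr0 : 0 < r := half_pos (lt_min hρ (by linarith))
  obtain ⟨η', hη', hη'w⟩ := Metric.continuous_iff.mp hwc 0 r hr0
  set η := min (η' / 2) (τ / 2) with hη
  have hη0 : 0 < η := lt_min (by linarith) (by linarith)
  have hη1 : η < η' := (min_le_left _ _).trans_lt (by linarith)
  have hη2 : η < τ := (min_le_right _ _).trans_lt (by linarith)
  have hvb : 0 < (w η).2 := h.snd_pos η ⟨hη0, hη2⟩
  have hva : 0 < (w (τ - η)).2 := h.snd_pos (τ - η) ⟨by linarith, by linarith⟩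
  have hwa : w (-η) = -w (τ - η) := by
    rw [← neg_eq_iff_eq_neg, ← hw.add_τ]; congr 1; ring
  set e := min (min ε r) (min (w η).2 (w (τ - η)).2) with he
  have he0 : 0 < e := lt_min (lt_min hε hr0) (lt_min hvb hva)
  refine ⟨min 1 (e / L), by positivity, fun z hz hz0 => ?_⟩
  obtain ⟨hz1, hz2⟩ := lt_min_iff.mp hz0
  obtain ⟨q, hq, hzq⟩ := hw.isCompact_range.exists_infDist_eq_dist (range_nonempty w) (z 0)
  rw [← hw.periodic.image_Icc (by linarith) 0] at hq
  obtain ⟨s, hs, rfl⟩ := hq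
  rw [hzq] at hz1 hz2
  rw [lt_div_iff₀' hL] at hz2
  have hper : ∀ t, w (t + 4 * τ) = w t := fun t => by
    rw [show t + 4 * τ = t + 2 * τ + 2 * τ by ring, hw.periodic, hw.periodic]
  have hnz : ‖z 0‖ ≤ R + 1 := by
    have h1 := hR _ (mem_range_self s)
    have h2 := norm_le_norm_add_norm_sub' (z 0) (w s)
    rw [← dist_eq_norm] at h2
    linarith
  have hnw : ‖w (0 + s)‖ ≤ R + 1 := by linarith [hR _ (mem_range_self (0 + s))]
  have hclose : ∀ t ∈ Icc 0 (5 * τ), dist (z t) (w (t + s)) < e := fun t ht => by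
    refine (hdist _ z (fun t => w (t + s)) le_rfl (IsIntegralCurveOn.mono hz Icc_subset_Ici_self)
      (IsIntegralCurveOn.mono (hw.isIntegralCurve.isForwardSolution_shift s) Icc_subset_Ici_self)
      hnz hnw t ht).trans_lt ?_
    rwa [zero_add]
  have hsnd : ∀ t ∈ Icc 0 (5 * τ), |(z t).2 - (w (t + s)).2| < e := fun t ht =>
    lt_of_le_of_lt (by rw [Prod.dist_eq]; exact le_max_right _ _) (hclose t ht)
  have hs2 := hs.2
  have hs1 := hs.1
  have ha0 : 0 ≤ 4 * τ - s - η := by linarith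
  have hb0 : 4 * τ - s + η ≤ 5 * τ := by linarith
  have hza : (z (4 * τ - s - η)).2 < 0 := by
    have h1 := hsnd _ ⟨ha0, by linarith⟩
    rw [show 4 * τ - s - η + s = -η + 4 * τ by ring, hper, hwa, Prod.snd_neg] at h1
    have h2 : e ≤ (w (τ - η)).2 := (min_le_right _ _).trans (min_le_right _ _)
    linarith [le_abs_self ((z (4 * τ - s - η)).2 - -(w (τ - η)).2)]
  have hzb : 0 < (z (4 * τ - s + η)).2 := by
    have h1 := hsnd _ ⟨by linarith, hb0⟩
    rw [show 4 * τ - s + η + s = η + 4 * τ by ring, hper] at h1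
    have h2 : e ≤ (w η).2 := (min_le_right _ _).trans (min_le_left _ _)
    linarith [neg_abs_le ((z (4 * τ - s + η)).2 - (w η).2)]
  obtain ⟨t, ht, ht0⟩ := intermediate_value_Icc (by linarith : 4 * τ - s - η ≤ 4 * τ - s + η)
    ((continuousOn_snd hz).mono (Icc_subset_Ici_zero ha0)) ⟨hza.le, hzb.le⟩
  have ht1 := ht.1
  have ht2 := ht.2
  have hfst : |(z t).1 + m| < min ρ (m - D.β) := by
    have h1 := hclose t ⟨by linarith, by linarith⟩
    have h2 := hη'w (t + s - 4 * τ) (by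
      rw [Real.dist_0_eq_abs, abs_lt]; constructor <;> linarith)
    rw [← hper, sub_add_cancel] at h2
    have h3 := (dist_triangle _ _ _).trans_lt (add_lt_add h1 h2)
    have h4 : e ≤ r := (min_le_left _ _).trans (min_le_right _ _)
    have h5 : dist (z t).1 (w 0).1 ≤ dist (z t) (w 0) := by
      rw [Prod.dist_eq]; exact le_max_left _ _
    rw [h.start, Real.dist_eq, sub_neg_eq_add] at h5
    rw [h.start] at h3
    have h6 : r + r = min ρ (m - D.β) := by rw [hr]; ring
    linarith
  obtain ⟨hf1, hf2⟩ := lt_min_iff.mp hfst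
  refine ⟨t, -(z t).1, by linarith, ?_, ?_, ?_, fun u hu => ?_⟩
  · linarith [le_abs_self ((z t).1 + m)]
  · rwa [← abs_neg, show -(-(z t).1 - m) = (z t).1 + m by ring]
  · rw [neg_neg]; exact Prod.ext rfl ht0
  · refine (Metric.infDist_le_dist_of_mem (mem_range_self (u + s))).trans_lt
      ((hclose u ⟨hu.1, by linarith [hu.2]⟩).trans_le ?_)
    exact (min_le_left _ _).trans (min_le_left _ _)

lemma isAttracting (hw : D.IsSymmetricCycle w m τ) : IsAttracting D.field (range w) := by
  constructor
  · obtain ⟨δ, hδ, hhit⟩ := hw.exists_hit one_pos one_pos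
    refine ⟨δ, hδ, fun p hp => ⟨D.exists_isForwardSolution p, ?_⟩⟩
    rintro z hz rfl
    obtain ⟨h, m₂, hh, hm₂, -, hzh, -⟩ := hhit z hz hp
    exact (hw.tendsto_infDist (hz.shift hh) (by simpa using hzh) hm₂).of_comp_add_const h
  · intro ε hε
    obtain ⟨ρ, hρ, hstab⟩ := hw.exists_forall_infDist_lt hε
    obtain ⟨δ, hδ, hhit⟩ := hw.exists_hit hε hρ
    refine ⟨δ, hδ, fun z hz hp t ht => ?_⟩
    obtain ⟨h, m₂, hh, hm₂, hlt, hzh, hnear⟩ := hhit z hz hp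
    rcases le_or_gt t h with hle | hgt
    · exact hnear t ⟨ht, hle⟩
    · have := hstab _ m₂ (hz.shift hh) (by simpa using hzh) hm₂ hlt (t - h) (by linarith)
      rwa [sub_add_cancel] at this

end IsSymmetricCycle

/-! ### Uniqueness of the closed orbit. -/

/-- The region of positive shifted energy is forward invariant. -/
lemma shiftedEnergy_pos_of_pos (hz : IsForwardSolution D.field z) {a b : ℝ} (ha : 0 ≤ a)
    (hab : a ≤ b) (hW : 0 < D.shiftedEnergy (z a)) : 0 < D.shiftedEnergy (z b) := by
  by_contra! hb
  have hcont := (continuousOn_shiftedEnergy hz).mono (Icc_subset_Ici_zero (b := b) ha)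
  have hclosed : IsCompact (Icc a b ∩ (fun t => D.shiftedEnergy (z t)) ⁻¹' Iic 0) :=
    isCompact_Icc.of_isClosed_subset (hcont.preimage_isClosed_of_isClosed isClosed_Icc isClosed_Iic)
      inter_subset_left
  obtain ⟨s, ⟨hs, hWs⟩, hmin⟩ := hclosed.exists_isLeast ⟨b, right_mem_Icc.mpr hab, hb⟩
  have hpos : ∀ t ∈ Ico a s, 0 < D.shiftedEnergy (z t) := fun t ht => by
    by_contra! h
    exact absurd (hmin ⟨⟨ht.1, ht.2.le.trans hs.2⟩, h⟩) (not_le.mpr ht.2)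
  obtain ⟨A, hA⟩ := (isCompact_Icc (a := a) (b := b)).bddAbove_image
    (f := fun t => D.f (z t).1)
    (D.continuous_f.comp_continuousOn ((continuousOn_fst hz).mono (Icc_subset_Ici_zero ha)))
  set B := 2 * max A 0
  have hfB : ∀ t ∈ Icc a s, -2 * D.f (z t).1 ≥ -B := fun t ht => by
    have := (hA ⟨t, ⟨ht.1, ht.2.trans hs.2⟩, rfl⟩ : D.f (z t).1 ≤ A)
    have := le_max_left A 0
    simp only [B]; linarith
  have hB : 0 ≤ B := by positivity
  -- Grönwall argument: `W' ≥ -B W` up to the first zero `s`. Inside the strip `W' ≥ 0`; outside `v²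
  -- ≤ W`. Hence `W exp (B t)` cannot reach zero.
  have hgrow := mul_sub_le_of_le_hasDerivAt (c := 0) hs.1
    (g := fun t => D.shiftedEnergy (z t) * Real.exp (B * t))
    (((continuousOn_shiftedEnergy hz).mono (Icc_subset_Ici_zero ha)).mul (by fun_prop))
    (fun t ht => (hasDerivAt_shiftedEnergy hz (ha.trans_lt ht.1)).mul
      (((hasDerivAt_id t).const_mul B).exp)) (fun t ht => by
        have h1 := hpos t ⟨ht.1.le, ht.2⟩
        have h2 := hfB t ⟨ht.1.le, ht.2.le⟩
        have h3 : 0 ≤ -2 * D.f (z t).1 * (z t).2 ^ 2 + D.shiftedEnergy (z t) * B := by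
          rcases le_or_gt |(z t).1| D.β with hx | hx
          · have h4 := D.f_nonpos hx
            have h5 := mul_nonneg (neg_nonneg.mpr h4) (sq_nonneg (z t).2)
            have h6 := mul_nonneg h1.le hB
            linarith
          · have h4 : (z t).2 ^ 2 ≤ D.shiftedEnergy (z t) := by
              have := D.level_pos hx
              unfold shiftedEnergy; linarith
            have h5 := mul_le_mul_of_nonneg_right h2 (sq_nonneg (z t).2)
            have h6 := mul_le_mul_of_nonneg_right h4 hB
            linarith
        have h7 := mul_nonneg h3 (Real.exp_nonneg (B * t))
        simp only [id, mul_one]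
        linarith)
  have h1 : 0 < D.shiftedEnergy (z a) * Real.exp (B * a) := by positivity
  have h2 : D.shiftedEnergy (z s) * Real.exp (B * s) ≤ 0 :=
    mul_nonpos_of_nonpos_of_nonneg hWs (Real.exp_nonneg _)
  linarith

/-- A nonconstant periodic solution reaches the region of positive shifted energy. -/
lemma exists_shiftedEnergy_pos (hz : IsIntegralCurve z (fun _ => D.field)) {T : ℝ} (hT : 0 < T)
    (hper : Function.Periodic z T) (hne : ∃ t, z t ≠ z 0) : ∃ t, 0 < D.shiftedEnergy (z t) := by
  -- With `W ≤ 0` the orbit stays in `|x| ≤ β`, where `W` is nondecreasing; periodicity makes it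
  -- constant, hence `v = 0` throughout and the solution is constant.
  by_contra! hW
  have hk := D.k_pos
  have hβ := D.β_pos
  have hx : ∀ t, |(z t).1| ≤ D.β := fun t => by
    by_contra! h
    have h1 := D.level_pos h
    have h2 := hW t
    unfold shiftedEnergy at h2
    linarith [sq_nonneg (z t).2]
  have hd : ∀ t, HasDerivAt (fun t => D.shiftedEnergy (z t)) (-2 * D.f (z t).1 * (z t).2 ^ 2) t := by
    intro t
    have h1 : HasDerivAt (fun s : ℝ => s + (1 - t)) 1 t := (hasDerivAt_id t).add_const _
    have h2 := hasDerivAt_shiftedEnergy (hz.isForwardSolution_shift (t - 1))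
      (t := t + (1 - t)) (by linarith)
    have h3 := h2.comp t h1
    simpa [Function.comp_def, show ∀ x, x + (1 - t) + (t - 1) = x from fun x => by ring]
      using! h3
  have hmono : Monotone (fun t => D.shiftedEnergy (z t)) := by
    refine monotone_of_deriv_nonneg (fun t => (hd t).differentiableAt) fun t => ?_
    rw [(hd t).deriv]
    have := mul_nonneg (neg_nonneg.mpr (D.f_nonpos (hx t))) (sq_nonneg (z t).2)
    linarith
  have hconst : ∀ s t, s ≤ t → D.shiftedEnergy (z t) = D.shiftedEnergy (z s) := by
    intro s t hst
    obtain ⟨n, hn⟩ := exists_nat_gt ((t - s) / T)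
    rw [div_lt_iff₀ hT] at hn
    refine le_antisymm ?_ (hmono hst)
    have h1 := hmono (show t ≤ s + n * T by linarith)
    simp only at h1
    rwa [hper.nat_mul n s] at h1
  have hconst' : (fun t => D.shiftedEnergy (z t)) = fun _ => D.shiftedEnergy (z 0) := by
    funext t
    rcases le_total 0 t with h | h
    · exact hconst 0 t h
    · exact (hconst t 0 h).symm
  have hv : ∀ t, (z t).2 = 0 := by
    intro t
    by_contra hv
    have h1 := hd t
    rw [hconst'] at h1
    have h2 := h1.unique (hasDerivAt_const t _)
    have h3 : D.f (z t).1 = 0 := by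
      rcases mul_eq_zero.mp h2 with h | h
      · linarith
      · exact absurd (pow_eq_zero_iff two_ne_zero |>.mp h) hv
    have h4 : |(z t).1| = D.β := (hx t).eq_of_not_lt fun h => (D.f_neg _ h).ne h3
    have h5 : D.level (z t).1 = 0 := by rw [level, ← sq_abs, h4]; simp
    have h6 := hW t
    rw [shiftedEnergy, h5] at h6
    have : 0 < (z t).2 ^ 2 := by positivity
    linarith
  obtain ⟨t, ht⟩ := hne
  refine ht (Prod.ext ?_ ((hv t).trans (hv 0).symm))
  have hdx : ∀ t, HasDerivAt (fun t => (z t).1) 0 t := fun t => by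
    have := hasFDerivAt_fst.comp_hasDerivAt t (hz t)
    simpa [field, hv t] using! this
  exact is_const_of_deriv_eq_zero (fun t => (hdx t).differentiableAt) (fun t => (hdx t).deriv) t 0

/-- A nonconstant periodic solution meets the `x`-axis outside `[-β, β]`. -/
lemma exists_snd_eq_zero (hz : IsIntegralCurve z (fun _ => D.field)) {T : ℝ} (hT : 0 < T)
    (hper : Function.Periodic z T) (hne : ∃ t, z t ≠ z 0) :
    ∃ t, (z t).2 = 0 ∧ D.β < |(z t).1| := by
  obtain ⟨a, ha⟩ := exists_shiftedEnergy_pos hz hT hper hne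
  -- Rolle over one period gives a zero of `v`; since `W > 0` persists, `|x| > β` there.
  obtain ⟨c, hc, hc0⟩ := exists_hasDerivAt_eq_zero (f := fun t => (z t).1)
    (f' := fun t => (z t).2) (show a < a + T by linarith)
    (continuous_fst.comp hz.continuous).continuousOn (congrArg Prod.fst (hper a)).symm
    (fun t _ => by simpa [field] using! hasFDerivAt_fst.comp_hasDerivAt t (hz t))
  have hW := shiftedEnergy_pos_of_pos (hz.isForwardSolution_shift a) le_rfl
    (show 0 ≤ c - a by linarith [hc.1]) (by simpa using ha)
  rw [sub_add_cancel, shiftedEnergy, hc0, zero_pow two_ne_zero, zero_add] at hW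
  refine ⟨c, hc0, ?_⟩
  by_contra! h
  exact absurd hW (not_lt.mpr (D.level_nonpos h))

/-- A symmetric cycle is the only closed orbit. -/
lemma IsSymmetricCycle.eq_of_isClosedOrbit {w : ℝ → ℝ × ℝ} {m τ : ℝ}
    (hw : D.IsSymmetricCycle w m τ) {Γ : Set (ℝ × ℝ)} (hΓ : IsClosedOrbit D.field Γ) :
    Γ = range w := by
  obtain ⟨z, hz, ⟨T, hT, hper⟩, hne, rfl⟩ := hΓ
  have hτ := hw.isHalfTurn.τ_pos
  obtain ⟨a, ha0, ha⟩ := exists_snd_eq_zero hz hT hper hne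
  have hza := hz.isForwardSolution_shift a
  have hlim : Tendsto (fun t => Metric.infDist (z (t + a)) (range w)) atTop (𝓝 0) := by
    rcases abs_cases (z a).1 with ⟨h1, _⟩ | ⟨h1, _⟩
    · have := hw.tendsto_infDist (neg_isForwardSolution hza) (m₁ := (z a).1)
        (by simp only [zero_add]; exact Prod.ext rfl (by simp [ha0])) (by linarith)
      simpa only [hw.infDist_neg] using this
    · exact hw.tendsto_infDist hza (m₁ := -(z a).1)
        (by simp only [zero_add, neg_neg]; exact Prod.ext rfl ha0) (by linarith)
  -- The distance to the cycle is periodic in time and tends to zero, so it vanishes.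
  have hzero : ∀ t, Metric.infDist (z t) (range w) = 0 := by
    intro t
    have h1 : Tendsto (fun n : ℕ => t - a + n * T) atTop atTop :=
      tendsto_atTop_add_const_left _ _ (tendsto_natCast_atTop_atTop.atTop_mul_const hT)
    have h2 := hlim.comp h1
    refine tendsto_nhds_unique (h2.congr fun n => ?_) tendsto_const_nhds |>.symm
    rw [Function.comp_apply, show t - a + n * T + a = t + n * T by ring, hper.nat_mul n t]
  obtain ⟨s, hs⟩ : z 0 ∈ range w :=
    (hw.isCompact_range.isClosed.mem_iff_infDist_zero (range_nonempty w)).mpr (hzero 0)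
  have heq : ∀ t, 0 ≤ t → z t = w (t + s) := fun t ht => by
    have := D.eq_of_isForwardSolution (hz.isForwardSolution_shift 0)
      (hw.isIntegralCurve.isForwardSolution_shift s) (by simp [hs]) ht
    simpa using this
  apply Subset.antisymm
  · rintro _ ⟨t, rfl⟩
    obtain ⟨n, hn⟩ := exists_nat_gt (-t / T)
    rw [div_lt_iff₀ hT] at hn
    exact ⟨t + n * T + s, by rw [← heq _ (by linarith), hper.nat_mul n t]⟩
  · rintro _ ⟨t, rfl⟩
    obtain ⟨n, hn⟩ := exists_nat_gt ((s - t) / (2 * τ))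
    rw [div_lt_iff₀ (by positivity)] at hn
    refine ⟨t + n * (2 * τ) - s, ?_⟩
    rw [heq _ (by linarith), sub_add_cancel, hw.periodic.nat_mul n t]

/-- A Liénard system has exactly one closed orbit, which is an attracting limit cycle. -/
theorem exists_attracting_limitCycle (D : LienardSystem) :
    ∃ Γ : Set (ℝ × ℝ), IsLimitCycle D.field Γ ∧ IsAttracting D.field Γ ∧
      ∀ Γ' : Set (ℝ × ℝ), IsClosedOrbit D.field Γ' → Γ' = Γ := by
  obtain ⟨w, m, τ, hw⟩ := D.exists_isSymmetricCycle
  exact ⟨range w, ⟨hw.isClosedOrbit, univ, isOpen_univ, subset_univ _,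
    fun _ h _ => hw.eq_of_isClosedOrbit h⟩, hw.isAttracting, fun _ h => hw.eq_of_isClosedOrbit h⟩

end LienardSystem

/-! ### The given system as a Liénard system. -/

/-- The quintic Liénard system with damping `-2 * (γ + a * x ^ 2 - b * x ^ 4)`. -/
lemma exists_lienardSystem_field_eq {γ a b E : ℝ} (ha : 0 < a) (hb : 0 < b) (hE : 0 < E)
    (hγ : 0 < γ) : ∃ D : LienardSystem, D.field = planarField γ a b E := by
  -- The positive root of `b s² = a s + γ`, so that `β = √s`: the damping factors as `2 (x² - s)(b
  -- x² + (b s - a))`, whose last factor is positive.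
  set s := (a + √(a ^ 2 + 4 * b * γ)) / (2 * b) with hs
  have hs0 : 0 < s := by positivity
  have hroot : b * s ^ 2 = a * s + γ := by
    have h1 : √(a ^ 2 + 4 * b * γ) ^ 2 = a ^ 2 + 4 * b * γ := Real.sq_sqrt (by positivity)
    rw [hs]
    generalize √(a ^ 2 + 4 * b * γ) = q at *
    field_simp
    linear_combination h1
  clear_value s
  have hbs : a < b * s := by
    by_contra! h
    nlinarith
  have hfac : ∀ x : ℝ, -2 * (γ + a * x ^ 2 - b * x ^ 4) =
      2 * (x ^ 2 - s) * (b * x ^ 2 + (b * s - a)) := fun x => by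
    linear_combination 2 * hroot
  have hsq : √s ^ 2 = s := Real.sq_sqrt hs0.le
  -- Ensures `S > s`, `S ≥ 1` and `b S / 5 > a / 3 + γ`; these give `b S² / 5 > a S / 3 + γ`, that
  -- is, `F √S > 0`.
  set S := 1 + s + 5 * (a / 3 + γ) / b with hS
  have hS0 : 0 < 5 * (a / 3 + γ) / b := by positivity
  have hSq : √S ^ 2 = S := Real.sq_sqrt (by positivity)
  refine ⟨{
    f := fun x => -2 * (γ + a * x ^ 2 - b * x ^ 4)
    F := fun x => -2 * (γ * x + a / 3 * x ^ 3 - b / 5 * x ^ 5)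
    k := 2 * E
    β := √s
    r := √S
    contDiff_f := by fun_prop
    hasDerivAt_F := fun x => ?_
    f_neg_arg := fun x => by ring
    F_neg_arg := fun x => by ring
    k_pos := by positivity
    β_pos := by positivity
    f_neg := fun x hx => ?_
    f_pos := fun x hx => ?_
    β_lt_r := Real.sqrt_lt_sqrt hs0.le (by linarith)
    F_r_pos := ?_ }, ?_⟩
  · have h1 := ((((hasDerivAt_id x).const_mul γ).add ((hasDerivAt_pow 3 x).const_mul (a / 3))).sub
      ((hasDerivAt_pow 5 x).const_mul (b / 5))).const_mul (-2)
    refine h1.congr_deriv ?_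
    norm_num
    ring
  · have h1 : x ^ 2 < s := by
      rw [← sq_abs, ← hsq]; gcongr
    have h2 : 0 < b * x ^ 2 + (b * s - a) := by nlinarith [sq_nonneg x]
    simp only [hfac]
    exact mul_neg_of_neg_of_pos (by linarith) h2
  · have h1 : s < x ^ 2 := by
      rw [← sq_abs, ← hsq]; gcongr
    have h2 : 0 < b * x ^ 2 + (b * s - a) := by nlinarith [sq_nonneg x]
    simp only [hfac]
    exact mul_pos (by linarith) h2
  · have h1 : -2 * (γ * √S + a / 3 * √S ^ 3 - b / 5 * √S ^ 5) =
        2 * √S * (b / 5 * S ^ 2 - a / 3 * S - γ) := by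
      linear_combination (-2 / 3 * a * √S + 2 / 5 * b * √S * (√S ^ 2 + S)) * hSq
    rw [h1]
    refine mul_pos (by positivity) ?_
    have h2 : b / 5 * S = b / 5 * (1 + s) + (a / 3 + γ) := by
      rw [hS]; field_simp
    have h3 : 1 ≤ S := by linarith
    have h4 : a / 3 + γ < b / 5 * S := by rw [h2]; linarith [show 0 < b / 5 * (1 + s) by positivity]
    have h5 : (a / 3 + γ) * S < b / 5 * S * S := mul_lt_mul_of_pos_right h4 (by linarith)
    nlinarith
  · funext p
    refine Prod.ext rfl ?_
    simp only [LienardSystem.field, planarField]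
    ring

theorem mainTheorem2 (γ a b E : ℝ) (ha : 0 < a) (hb : 0 < b) (hE : 0 < E) (hγ : 0 < γ) :
    ∃ Γ : Set (ℝ × ℝ),
      PlanarFlow.IsLimitCycle (PlanarFlow.planarField γ a b E) Γ ∧
      PlanarFlow.IsAttracting (PlanarFlow.planarField γ a b E) Γ ∧
      ∀ Γ' : Set (ℝ × ℝ), PlanarFlow.IsClosedOrbit (PlanarFlow.planarField γ a b E) Γ' →
        Γ' = Γ := by
  obtain ⟨D, hD⟩ := exists_lienardSystem_field_eq ha hb hE hγ
  rw [← hD]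
  exact D.exists_attracting_limitCycle
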